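/- Fix an integer $m\ge 2$ and a real $\delta>0$. Let $(G_n)_{n\ge1}$ be the preferential attachment multigraph with $G_n$ on the vertices $0,1,\dots,n$: $G_1$ consists of the vertices $0,1$ and $m$ parallel edges between them, and $G_{n+1}$ is obtained from $G_n$ by adding the vertex $n+1$ and $m$ edges from it whose other endpoints are drawn, conditionally on $G_n$, independently from $\{0,\dots,n\}$, each being equal to $i$ with probability $$\frac{\deg_{G_n}(i)+\delta}{(2m+\delta)n+\delta}.$$ (The one-vertex graph $G_0$ is also allowed.) Put $\tau=3+\delta/m$. Let $H$ be a connected simple graph on $k$ vertices with minimum degree at least $2$ and at least $k+1$ edges, and let $\pi:V(H)\to\{1,\dots,k\}$ be a bijection. For a vertex $v$ of $H$ let $d^{in}_H(v)$ and $d^{out}_H(v)$ be the numbers of neighbours $u$ of $v$ with $\pi(u)>\pi(v)$ and with $\pi(u)<\pi(v)$, respectively. Let $N_n(H,\pi)$ be the number of different subgraphs of $G_n$ that are isomorphic to $H$ by an isomorphism under which smaller labels in $G_n$ correspond to smaller values of $\pi$. Then there are constants $0<C_1\le C_2<\infty$, depending only on $m,\delta,H,\pi$, such that $\mathbb E N_n(H,\pi)\le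 C_2$ for all $n$ and, provided that $d^{out}_H(v)\le m$ for all vertices $v$ of $H$, $\mathbb E N_n(H,\pi)\ge C_1$ for all $n$ with $n+1\ge k$. The same bounds hold, with the same constants, whether parallel edges of $G_n$ are regarded as different edges in the count $N_n(H,\pi)$ or are merged into one edge. Moreover, $$B(H,\pi):=\max_{s=0,1,\dots,k}\Big\{-s-\sum_{i=s+1}^k\Big(\tfrac{1}{\tau-1}d_H^{in}(\pi^{-1}(i))+\big(1-\tfrac1{\tau-1}\big)d_H^{out}(\pi^{-1}(i))\Big)\Big\}=-k,$$ and the maximum is attained only at $s=k$. -/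

import Mathlib

open scoped BigOperators ENNReal

namespace PrefAttach

/-- The possible outcomes of the first `n` attachment steps with `m` edges per step. Step `i`
(`i = 0, …, n - 1`) adds the vertex `i + 1`, and `h i j` is the vertex among `0, …, i` to which
the `j`-th edge of the new vertex is joined. Such an `h` is the multigraph `G_n` on the vertices
`0, …, n` with edges labelled by `Fin n × Fin m`. -/
abbrev History (m n : ℕ) : Type := (i : Fin n) → Fin m → Fin ((i : ℕ) + 1)

variable {m n : ℕ}

/-- The younger endpoint `i + 1` of the edge `(i, j)`. -/
def newEnd (e : Fin n × Fin m) : Fin (n + 1) := e.1.succ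

/-- The older endpoint of an edge. -/
def oldEnd (h : History m n) (e : Fin n × Fin m) : Fin (n + 1) :=
  Fin.castLE (Nat.succ_le_succ e.1.isLt.le) (h e.1 e.2)

/-- The unordered pair of endpoints of an edge. -/
def ends (h : History m n) (e : Fin n × Fin m) : Sym2 (Fin (n + 1)) :=
  s(newEnd e, oldEnd h e)

/-- Degree of a vertex in the multigraph, parallel edges counted with multiplicity
(there are no loops). -/
def degree (h : History m n) (v : Fin (n + 1)) : ℕ :=
  (Finset.univ.filter fun e : Fin n × Fin m => newEnd e = v).card +
    (Finset.univ.filter fun e : Fin n × Fin m => oldEnd h e = v).card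

theorem sum_degree (h : History m n) : ∑ v, degree h v = 2 * m * n := by
  have key : ∀ f : Fin n × Fin m → Fin (n + 1),
      ∑ v, (Finset.univ.filter fun e : Fin n × Fin m => f e = v).card = n * m := by
    intro f
    rw [← Finset.card_eq_sum_card_fiberwise (fun _ _ => Finset.mem_coe.2 (Finset.mem_univ _))]
    simp
  simp only [degree, Finset.sum_add_distrib, key]
  ring

/-- Conditional probability, given `G_n`, that a given edge of the new vertex `n + 1` is drawn to
the vertex `v`. -/
noncomputable def attachProb (δ : ℝ) (h : History m n) (v : Fin (n + 1)) : ℝ :=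
  ((degree h v : ℝ) + δ) / ((2 * (m : ℝ) + δ) * (n : ℝ) + δ)

theorem attachProb_nonneg {δ : ℝ} (hδ : 0 < δ) (h : History m n) (v : Fin (n + 1)) :
    0 ≤ attachProb δ h v := by
  unfold attachProb
  positivity

theorem sum_attachProb {δ : ℝ} (hδ : 0 < δ) (h : History m n) :
    ∑ v, attachProb δ h v = 1 := by
  have hpos : 0 < (2 * (m : ℝ) + δ) * (n : ℝ) + δ := by positivity
  have hs : (∑ v, (degree h v : ℝ)) = 2 * m * n := by exact_mod_cast sum_degree h
  simp only [attachProb]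
  rw [← Finset.sum_div, Finset.sum_add_distrib, hs, div_eq_one_iff_eq hpos.ne']
  simp
  ring

theorem sum_prod_attachProb {δ : ℝ} (hδ : 0 < δ) (h : History m n) :
    ∑ x : Fin m → Fin (n + 1), ENNReal.ofReal (∏ j, attachProb δ h (x j)) = 1 := by
  rw [← ENNReal.ofReal_sum_of_nonneg
    (fun x _ => Finset.prod_nonneg fun j _ => attachProb_nonneg hδ h (x j))]
  have := Finset.prod_univ_sum (fun _ : Fin m => (Finset.univ : Finset (Fin (n + 1))))
    (fun _ v => attachProb δ h v)
  rw [Fintype.piFinset_univ] at this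
  rw [← this]
  simp [sum_attachProb hδ h]

/-- One attachment step: given `G_n`, the `m` targets are drawn independently, each with
probabilities `attachProb`. -/
noncomputable def stepLaw {δ : ℝ} (hδ : 0 < δ) (h : History m n) : PMF (Fin m → Fin (n + 1)) :=
  PMF.ofFintype (fun x => ENNReal.ofReal (∏ j, attachProb δ h (x j))) (sum_prod_attachProb hδ h)

/-- Add the vertex `n + 1` with its `m` edges to `G_n`. -/
def extend (h : History m n) (x : Fin m → Fin (n + 1)) : History m (n + 1) :=
  Fin.snoc (α := fun i : Fin (n + 1) => Fin m → Fin ((i : ℕ) + 1)) h x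

/-- The law of `G_n`. `G_0` is the single vertex `0`; its only possible continuation `G_1`
consists of the vertices `0, 1` and `m` parallel edges between them. -/
noncomputable def law (m : ℕ) {δ : ℝ} (hδ : 0 < δ) : (n : ℕ) → PMF (History m n)
  | 0 => PMF.pure (fun i => i.elim0)
  | n + 1 => (law m hδ n).bind fun h => (stepLaw hδ h).map (extend h)

/-- Expectation of a function of `G_n` (a finite sum over all outcomes). -/
noncomputable def expect (m : ℕ) {δ : ℝ} (hδ : 0 < δ) (n : ℕ) (X : History m n → ℝ) : ℝ :=
  ∑ h, (law m hδ n h).toReal * X h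

variable {W : Type*} {k : ℕ}

/-- The subgraph of the multigraph `G_n` with vertex set `V` and edge set `E` is a copy of `H`
that respects the ordering `π`: there is an isomorphism `(φ, ψ)` from `H` to it that respects
incidence and under which older vertices (smaller labels) correspond to smaller `π`. -/
def IsCopy (H : SimpleGraph W) (π : W ≃ Fin k) (h : History m n)
    (V : Finset (Fin (n + 1))) (E : Finset (Fin n × Fin m)) : Prop :=
  ∃ (φ : W ≃ V) (ψ : H.edgeSet ≃ E),
    (∀ e : H.edgeSet, ends h (ψ e).1 = Sym2.map (fun w => (φ w).1) e.1) ∧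
    ∀ u v : W, π u < π v ↔ (φ u).1 < (φ v).1

/-- `N_n(H, π)`: the number of different subgraphs of the multigraph `G_n` (parallel edges are
different edges) that are copies of `H` respecting `π`. -/
noncomputable def copies (H : SimpleGraph W) (π : W ≃ Fin k) (h : History m n) : ℕ :=
  {p : Finset (Fin (n + 1)) × Finset (Fin n × Fin m) | IsCopy H π h p.1 p.2}.ncard

/-- The simple graph underlying `G_n`: parallel edges are merged. -/
def simple (h : History m n) : SimpleGraph (Fin (n + 1)) :=
  SimpleGraph.fromEdgeSet (Set.range (ends h))

/-- The number of different subgraphs of the simple graph underlying `G_n` that are copies of `H`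
respecting `π`. -/
noncomputable def simpleCopies (H : SimpleGraph W) (π : W ≃ Fin k) (h : History m n) : ℕ :=
  {G' : (simple h).Subgraph |
    ∃ φ : H ≃g G'.coe, ∀ u v : W, π u < π v ↔ (φ u).1 < (φ v).1}.ncard

/-- Number of neighbours of `v` that come later than `v` in the ordering `π`. -/
def inDeg [Fintype W] (H : SimpleGraph W) [DecidableRel H.Adj] (π : W ≃ Fin k) (v : W) : ℕ :=
  (Finset.univ.filter fun u => H.Adj v u ∧ π v < π u).card

/-- Number of neighbours of `v` that come earlier than `v` in the ordering `π`. -/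
def outDeg [Fintype W] (H : SimpleGraph W) [DecidableRel H.Adj] (π : W ≃ Fin k) (v : W) : ℕ :=
  (Finset.univ.filter fun u => H.Adj v u ∧ π u < π v).card

/-- The exponent of the power-law degree distribution. -/
noncomputable def tau (m : ℕ) (δ : ℝ) : ℝ := 3 + δ / (m : ℝ)

/-- `-s - ∑_{i = s + 1}^{k} (d_in(π⁻¹ i) / (τ - 1) + (1 - 1 / (τ - 1)) d_out(π⁻¹ i))`; positions
are numbered from `0` here, so the sum is over the positions `≥ s`. -/
noncomputable def exponentAt [Fintype W] (H : SimpleGraph W) [DecidableRel H.Adj]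
    (π : W ≃ Fin k) (m : ℕ) (δ : ℝ) (s : ℕ) : ℝ :=
  -(s : ℝ) - ∑ i ∈ Finset.univ.filter (fun i : Fin k => s ≤ (i : ℕ)),
    (1 / (tau m δ - 1) * (inDeg H π (π.symm i) : ℝ) +
      (1 - 1 / (tau m δ - 1)) * (outDeg H π (π.symm i) : ℝ))

/-- `B(H, π)`, the maximum of `exponentAt` over `s = 0, 1, …, k`. -/
noncomputable def exponent [Fintype W] (H : SimpleGraph W) [DecidableRel H.Adj]
    (π : W ≃ Fin k) (m : ℕ) (δ : ℝ) : ℝ :=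
  (Finset.range (k + 1)).sup' Finset.nonempty_range_add_one (exponentAt H π m δ)

end PrefAttach

/-! Upper bound: by the first moment method, sum over all increasing placements of the vertices of
`H` and all choices of edge labels the probability that the required edges are present. To bound
this probability, weight the event that the edges prescribed so far are present by a product over
vertices of rising factorials of degree + δ, whose lengths count the prescribed edges still to
arrive there. In one step this weight grows in mean by at most an explicit factor that splits over
the prescribed edges (`sum_prod_attachProb_le`), and at the end it is the plain indicator. With β =
m / (2m + δ) = 1 / (τ - 1) < 1/2, an edge between labels u < v then costs about u^(-β) v^(-(1-β))
(`exists_edge_bound`).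

The combinatorial input is `tail_sum_vertexExponent`: the exponents of the vertices at positions ≥ s
sum to at least k - s + (1/2 - β). Abel summation against the increasing logarithms of the labels
bounds the probability by a constant times the product of label^(-(1+η)), with η > 0, which is
summable over all placements. The same tail inequality shows that B(H, π) is attained only at s = k.

Lower bound: the probability that some copy exists is nondecreasing in n. At n + 1 = k it is
positive, since out-degrees at most m permit a suitable history and every history has positive
probability.

Both ways of counting lie between the indicator that an embedding exists and the number of
embeddings, so the same constants serve for both. -/

namespace PrefAttach

/-! ### The one-step recursion for the law, expectations and degrees -/

section Recursion

variable {m n : ℕ} {δ : ℝ}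

theorem extend_injective {h h' : History m n} {x x' : Fin m → Fin (n + 1)}
    (e : extend h x = extend h' x') : h = h' ∧ x = x' := by
  have := Fin.snoc_injective2 (α := fun i : Fin (n + 1) => Fin m → Fin ((i : ℕ) + 1)) e
  exact this

theorem extend_castSucc (h : History m n) (x : Fin m → Fin (n + 1)) (i : Fin n) :
    extend h x i.castSucc = h i :=
  Fin.snoc_castSucc (α := fun i : Fin (n + 1) => Fin m → Fin ((i : ℕ) + 1)) x h i

theorem extend_last (h : History m n) (x : Fin m → Fin (n + 1)) :
    extend h x (Fin.last n) = x :=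
  Fin.snoc_last (α := fun i : Fin (n + 1) => Fin m → Fin ((i : ℕ) + 1)) x h

theorem law_succ_extend (hδ : 0 < δ) (h : History m n) (x : Fin m → Fin (n + 1)) :
    law m hδ (n + 1) (extend h x) = law m hδ n h * stepLaw hδ h x := by
  classical
  simp only [law, PMF.bind_apply, PMF.map_apply, tsum_fintype]
  rw [Finset.sum_eq_single h]
  · rw [Finset.sum_eq_single x]
    · simp
    · intro b _ hb
      rw [if_neg]
      intro e
      exact hb (extend_injective e).2.symm
    · simp
  · intro b _ hb
    rw [Finset.sum_eq_zero, mul_zero]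
    intro y _
    rw [if_neg]
    intro e
    exact hb (extend_injective e).1.symm
  · simp

theorem stepLaw_toReal (hδ : 0 < δ) (h : History m n) (x : Fin m → Fin (n + 1)) :
    (stepLaw hδ h x).toReal = ∏ j, attachProb δ h (x j) := by
  rw [stepLaw, PMF.ofFintype_apply, ENNReal.toReal_ofReal]
  exact Finset.prod_nonneg fun j _ => attachProb_nonneg hδ h (x j)

theorem expect_zero (hδ : 0 < δ) (X : History m 0 → ℝ) :
    expect m hδ 0 X = X (fun i => i.elim0) := by
  rw [expect, Fintype.sum_eq_single (fun i => i.elim0)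
    fun b hb => (hb (Subsingleton.elim _ _)).elim]
  simp [law]

/-- The tower property: a history of length n + 1 is uniquely a history of length n followed by one
row of targets. -/
theorem expect_succ (hδ : 0 < δ) (X : History m (n + 1) → ℝ) :
    expect m hδ (n + 1) X =
      expect m hδ n fun h => ∑ x, (∏ j, attachProb δ h (x j)) * X (extend h x) := by
  rw [expect, expect,
    ← (Fin.snocEquiv fun i : Fin (n + 1) => Fin m → Fin ((i : ℕ) + 1)).sum_comp,
    Fintype.sum_prod_type_right]
  refine Finset.sum_congr rfl fun h _ => ?_
  rw [Finset.mul_sum]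
  refine Finset.sum_congr rfl fun x _ => ?_
  change (law m hδ (n + 1) (extend h x)).toReal * X (extend h x) = _
  rw [law_succ_extend, ENNReal.toReal_mul, stepLaw_toReal, mul_assoc]

theorem expect_mono (hδ : 0 < δ) {X Y : History m n → ℝ} (hXY : ∀ h, X h ≤ Y h) :
    expect m hδ n X ≤ expect m hδ n Y :=
  Finset.sum_le_sum fun h _ => mul_le_mul_of_nonneg_left (hXY h) ENNReal.toReal_nonneg

theorem expect_const_mul (hδ : 0 < δ) (a : ℝ) (X : History m n → ℝ) :
    expect m hδ n (fun h => a * X h) = a * expect m hδ n X := by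
  rw [expect, expect, Finset.mul_sum]
  exact Finset.sum_congr rfl fun h _ => by ring

theorem expect_sum (hδ : 0 < δ) {ι : Type*} (s : Finset ι) (X : ι → History m n → ℝ) :
    expect m hδ n (fun h => ∑ a ∈ s, X a h) = ∑ a ∈ s, expect m hδ n (X a) := by
  simp only [expect, Finset.mul_sum]
  exact Finset.sum_comm

theorem sum_prod_attachProb_real (hδ : 0 < δ) (h : History m n) :
    ∑ x : Fin m → Fin (n + 1), ∏ j, attachProb δ h (x j) = 1 := by
  have := Finset.prod_univ_sum (fun _ : Fin m => (Finset.univ : Finset (Fin (n + 1))))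
    (fun _ v => attachProb δ h v)
  rw [Fintype.piFinset_univ] at this
  rw [← this]
  simp [sum_attachProb hδ h]

theorem attachProb_pos (hδ : 0 < δ) (h : History m n) (v : Fin (n + 1)) :
    0 < attachProb δ h v := by
  unfold attachProb
  positivity

/-- Since δ > 0, even a vertex of degree 0 is drawn with positive probability. This turns one
suitable history into a lower bound. -/
theorem law_toReal_pos (hδ : 0 < δ) : ∀ {n : ℕ} (h : History m n), 0 < (law m hδ n h).toReal
  | 0, h => by
    have : h = fun i => i.elim0 := Subsingleton.elim _ _
    rw [this]
    simp [law]
  | n + 1, h => by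
    have e : h = extend (fun i => h i.castSucc) (h (Fin.last n)) :=
      (Fin.snoc_init_self (α := fun i : Fin (n + 1) => Fin m → Fin ((i : ℕ) + 1)) h).symm
    rw [e, law_succ_extend, ENNReal.toReal_mul, stepLaw_toReal]
    exact mul_pos (law_toReal_pos hδ _) (Finset.prod_pos fun j _ => attachProb_pos hδ _ _)

theorem degree_extend_castSucc (h : History m n) (x : Fin m → Fin (n + 1)) (v : Fin (n + 1)) :
    degree (extend h x) v.castSucc = degree h v + ∑ j, if x j = v then 1 else 0 := by
  classical
  simp only [degree, Finset.card_filter, Fintype.sum_prod_type, Fin.sum_univ_castSucc]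
  have e1 : ∀ (i : Fin n) (j : Fin m),
      newEnd ((i.castSucc, j) : Fin (n + 1) × Fin m) = (newEnd (i, j)).castSucc := fun _ _ => rfl
  have e2 : ∀ j : Fin m, newEnd ((Fin.last n, j) : Fin (n + 1) × Fin m) ≠ v.castSucc :=
    fun j => (Fin.castSucc_lt_last v).ne'
  have e3 : ∀ (i : Fin n) (j : Fin m),
      oldEnd (extend h x) (i.castSucc, j) = (oldEnd h (i, j)).castSucc := by
    intro i j
    simp only [oldEnd, extend_castSucc]
    rfl
  have e4 : ∀ j : Fin m, oldEnd (extend h x) (Fin.last n, j) = (x j).castSucc := by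
    intro j
    simp only [oldEnd, extend_last]
    rfl
  simp only [e1, e2, e3, e4, Fin.castSucc_inj, if_false, Finset.sum_const_zero, add_zero]
  ring

theorem degree_extend_last (h : History m n) (x : Fin m → Fin (n + 1)) :
    degree (extend h x) (Fin.last (n + 1)) = m := by
  classical
  simp only [degree, Finset.card_filter, Fintype.sum_prod_type, Fin.sum_univ_castSucc]
  have e1 : ∀ (i : Fin n) (j : Fin m),
      newEnd ((i.castSucc, j) : Fin (n + 1) × Fin m) ≠ Fin.last (n + 1) :=
    fun i j => (Fin.castSucc_lt_last (newEnd (i, j))).ne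
  have e2 : ∀ j : Fin m, newEnd ((Fin.last n, j) : Fin (n + 1) × Fin m) = Fin.last (n + 1) :=
    fun j => rfl
  have e3 : ∀ e : Fin (n + 1) × Fin m, oldEnd (extend h x) e ≠ Fin.last (n + 1) := by
    intro e
    refine Fin.ne_of_lt ?_
    have := (extend h x e.1 e.2).isLt
    have := e.1.isLt
    simp only [Fin.lt_def, oldEnd, Fin.val_castLE, Fin.val_last]
    omega
  simp [e1, e2, e3]

end Recursion

/-! ### Rising factorials -/

section Rising

/-- The rising factorial `y (y + 1) ⋯ (y + q - 1)`. -/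
noncomputable def rising (y : ℝ) (q : ℕ) : ℝ := ∏ i ∈ Finset.range q, (y + i)

theorem rising_succ_right (y : ℝ) (q : ℕ) : rising y (q + 1) = rising y q * (y + q) :=
  Finset.prod_range_succ _ _

theorem rising_succ_left (y : ℝ) (q : ℕ) : rising y (q + 1) = y * rising (y + 1) q := by
  rw [rising, Finset.prod_range_succ', mul_comm, rising]
  simp only [Nat.cast_zero, add_zero, Nat.cast_add, Nat.cast_one]
  congr 1
  exact Finset.prod_congr rfl fun i _ => by ring

theorem rising_pos {y : ℝ} (hy : 0 < y) (q : ℕ) : 0 < rising y q :=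
  Finset.prod_pos fun i _ => by positivity

/-- Splitting off the first or the last factor gives y · (y+1)⋯(y+q) in two ways. The relative gain
q / y cancels the degree in the attachment probability, which is why rising factorials are the right
weights. -/
theorem rising_add_one {y : ℝ} (hy : 0 < y) (q : ℕ) :
    rising (y + 1) q = rising y q * (1 + q / y) := by
  have h := rising_succ_left y q
  rw [rising_succ_right] at h
  field_simp
  linarith

theorem rising_le_pow {y K : ℝ} (hy : 0 ≤ y) {q : ℕ} (hK : y + q ≤ K) : rising y q ≤ K ^ q := by
  rw [rising, ← Finset.card_range q, ← Finset.prod_const, Finset.card_range]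
  refine Finset.prod_le_prod (fun i _ => by positivity) fun i hi => ?_
  have : (i : ℝ) ≤ q := by exact_mod_cast (Finset.mem_range.1 hi).le
  linarith

end Rising

/-! ### Draws of one attachment step, in an abstract weighted set -/

section Step

variable {V : Type*} [Fintype V] [DecidableEq V] {D : V → ℝ} {L : ℝ}

theorem prod_rising_increment (y : V → ℝ) (hy : ∀ v, 0 < y v) (r : V → ℕ) (a : V) :
    ∏ v, rising (y v + if a = v then 1 else 0) (r v) =
      (∏ v, rising (y v) (r v)) * (1 + r a / y a) := by
  rw [← Finset.mul_prod_erase _ _ (Finset.mem_univ a), if_pos rfl, rising_add_one (hy a),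
    ← Finset.mul_prod_erase _ (fun v => rising (y v) (r v)) (Finset.mem_univ a)]
  have : ∏ v ∈ Finset.univ.erase a, rising (y v + if a = v then 1 else 0) (r v) =
      ∏ v ∈ Finset.univ.erase a, rising (y v) (r v) := by
    refine Finset.prod_congr rfl fun v hv => ?_
    rw [if_neg (Finset.ne_of_mem_erase hv).symm, add_zero]
  rw [this]
  ring

/-- When a prescribed edge hits a, the numerator of its probability is absorbed as one more factor
of the rising factorial at a. -/
theorem prod_rising_succ (y : V → ℝ) (r : V → ℕ) (a : V) :
    ∏ v, rising (y v) (r v + if a = v then 1 else 0) =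
      y a * ∏ v, rising (y v + if a = v then 1 else 0) (r v) := by
  rw [← Finset.mul_prod_erase _ _ (Finset.mem_univ a), if_pos rfl, rising_succ_left,
    ← Finset.mul_prod_erase _ (fun v => rising (y v + if a = v then 1 else 0) (r v))
      (Finset.mem_univ a), if_pos rfl, mul_assoc]
  congr 2
  refine Finset.prod_congr rfl fun v hv => ?_
  simp [(Finset.ne_of_mem_erase hv).symm]

/-- Here D is the weight frozen at the start of the step and y the weight including earlier draws of
the same step, so D ≤ y. Two prescribed targets make the left side vanish. One target contributes D
/ L ≤ y / L, absorbed by `prod_rising_succ`. With no target, the average gain is the sum of (D /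
L)(r / y), at most the sum of r / L. -/
theorem sum_draw_le (hD : ∀ v, 0 < D v) (hL : ∑ v, D v = L) (hL0 : 0 < L)
    (c : Finset V) (r : V → ℕ) (y : V → ℝ) (hy : ∀ v, D v ≤ y v) :
    ∑ a, D a / L * ((if ∀ v ∈ c, a = v then 1 else 0) *
        ∏ v, rising (y v + if a = v then 1 else 0) (r v)) ≤
      (1 + (∑ v, (r v : ℝ)) / L) * L⁻¹ ^ c.card *
        ∏ v, rising (y v) (r v + if v ∈ c then 1 else 0) := by
  have hy0 : ∀ v, 0 < y v := fun v => (hD v).trans_le (hy v)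
  have hR : (0 : ℝ) ≤ (∑ v, (r v : ℝ)) / L := by positivity
  rcases Nat.lt_or_ge 1 c.card with h1 | h1
  · obtain ⟨v, hv, w, hw, hvw⟩ := Finset.one_lt_card.1 h1
    rw [Finset.sum_eq_zero]
    · have : 0 < ∏ v, rising (y v) (r v + if v ∈ c then 1 else 0) :=
        Finset.prod_pos fun v _ => rising_pos (hy0 v) _
      positivity
    · intro a _
      rw [if_neg]
      · simp
      · intro h
        exact hvw ((h v hv).symm.trans (h w hw))
  rcases Nat.lt_or_ge 0 c.card with h0 | h0
  · obtain ⟨v₀, rfl⟩ := Finset.card_eq_one.1 (le_antisymm h1 h0)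
    rw [Finset.sum_eq_single v₀]
    · have e : ∀ v, (if v ∈ ({v₀} : Finset V) then 1 else 0) = if v₀ = v then 1 else 0 := by
        intro v
        simp [eq_comm]
      simp only [e, prod_rising_succ]
      have hP : 0 < ∏ v, rising (y v + if v₀ = v then 1 else 0) (r v) :=
        Finset.prod_pos fun v _ => rising_pos (by have := hy0 v; positivity) _
      set P := ∏ v, rising (y v + if v₀ = v then 1 else 0) (r v)
      simp only [Finset.mem_singleton, forall_eq, if_true, one_mul, Finset.card_singleton, pow_one]
      calc D v₀ / L * P ≤ y v₀ / L * P := by gcongr; exact hy v₀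
        _ = 1 * L⁻¹ * (y v₀ * P) := by ring
        _ ≤ (1 + (∑ v, (r v : ℝ)) / L) * L⁻¹ * (y v₀ * P) := by
          have := hy0 v₀
          gcongr
          linarith
    · intro a _ ha
      rw [if_neg (by simpa using ha)]
      simp
    · simp
  · obtain rfl : c = ∅ := Finset.card_eq_zero.1 (Nat.le_zero.1 h0)
    simp only [Finset.notMem_empty, false_imp_iff, implies_true, if_true, one_mul, if_false,
      add_zero, Finset.card_empty, pow_zero, mul_one]
    have hP : 0 < ∏ v, rising (y v) (r v) := Finset.prod_pos fun v _ => rising_pos (hy0 v) _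
    simp only [prod_rising_increment y hy0]
    set P := ∏ v, rising (y v) (r v)
    calc ∑ a, D a / L * (P * (1 + r a / y a))
        ≤ ∑ a, (D a / L + r a / L) * P := by
          refine Finset.sum_le_sum fun a _ => ?_
          have : D a / L * (r a / y a) ≤ r a / L := by
            rw [div_mul_div_comm, div_le_div_iff₀ (by have := hy0 a; positivity) hL0]
            have h2 := mul_le_mul_of_nonneg_right (hy a) (by positivity : (0:ℝ) ≤ r a * L)
            linarith
          have := mul_le_mul_of_nonneg_right this hP.le
          linarith
      _ = _ := by
          rw [← Finset.sum_mul, Finset.sum_add_distrib, ← Finset.sum_div, hL, div_self hL0.ne',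
            Finset.sum_div]

/-- Induction on the number of draws, peeling off the first one. The probabilities D / L stay fixed
while y is raised by the draw, so the induction must be over all y ≥ D. -/
theorem sum_draws_le (hD : ∀ v, 0 < D v) (hL : ∑ v, D v = L) (hL0 : 0 < L) :
    ∀ (m : ℕ) (c : Fin m → Finset V) (q : V → ℕ) (y : V → ℝ), (∀ v, D v ≤ y v) →
    ∑ x : Fin m → V, (∏ j, D (x j) / L) * ((if ∀ j, ∀ v ∈ c j, x j = v then 1 else 0) *
        ∏ v, rising (y v + (∑ j, if x j = v then 1 else 0 : ℕ)) (q v)) ≤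
      (1 + (∑ v, ((q v + ∑ j, if v ∈ c j then 1 else 0 : ℕ) : ℝ)) / L) ^ m *
        L⁻¹ ^ (∑ j, (c j).card) * ∏ v, rising (y v) (q v + ∑ j, if v ∈ c j then 1 else 0)
  | 0, c, q, y, hy => by simp
  | m + 1, c, q, y, hy => by
    have hy0 : ∀ v, 0 < y v := fun v => (hD v).trans_le (hy v)
    rw [← (Fin.consEquiv fun _ : Fin (m + 1) => V).sum_comp, Fintype.sum_prod_type]
    set r : V → ℕ := fun v => q v + ∑ j : Fin m, if v ∈ c j.succ then 1 else 0 with hr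
    set Q : ℝ := ∑ v, (r v : ℝ) with hQ
    have hQ0 : 0 ≤ Q := by positivity
    calc _ = ∑ a, D a / L * ((if ∀ v ∈ c 0, a = v then 1 else 0) *
          ∑ x : Fin m → V, (∏ j, D (x j) / L) *
            ((if ∀ j : Fin m, ∀ v ∈ c j.succ, x j = v then 1 else 0) *
            ∏ v, rising ((y v + if a = v then 1 else 0) +
              (∑ j, if x j = v then 1 else 0 : ℕ)) (q v))) := by
          refine Finset.sum_congr rfl fun a _ => ?_
          rw [Finset.mul_sum, Finset.mul_sum]
          refine Finset.sum_congr rfl fun x _ => ?_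
          simp only [Fin.consEquiv_apply, Fin.prod_univ_succ, Fin.cons_zero, Fin.cons_succ,
            Fin.forall_fin_succ, Fin.sum_univ_succ, Nat.cast_add, Nat.cast_ite, Nat.cast_one,
            Nat.cast_zero, ← add_assoc, ite_and]
          split_ifs <;> ring
      _ ≤ ∑ a, D a / L * ((if ∀ v ∈ c 0, a = v then 1 else 0) *
            ((1 + Q / L) ^ m * L⁻¹ ^ (∑ j : Fin m, (c j.succ).card) *
              ∏ v, rising (y v + if a = v then 1 else 0) (r v))) := by
          refine Finset.sum_le_sum fun a _ => ?_
          have := hD a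
          gcongr
          refine sum_draws_le hD hL hL0 m (fun j => c j.succ) q
            (fun v => y v + if a = v then 1 else 0) fun v => ?_
          split_ifs
          · linarith [hy v]
          · linarith [hy v]
      _ = (1 + Q / L) ^ m * L⁻¹ ^ (∑ j : Fin m, (c j.succ).card) *
            ∑ a, D a / L * ((if ∀ v ∈ c 0, a = v then 1 else 0) *
              ∏ v, rising (y v + if a = v then 1 else 0) (r v)) := by
          rw [Finset.mul_sum]
          exact Finset.sum_congr rfl fun a _ => by ring
      _ ≤ (1 + Q / L) ^ m * L⁻¹ ^ (∑ j : Fin m, (c j.succ).card) *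
            ((1 + Q / L) * L⁻¹ ^ (c 0).card *
              ∏ v, rising (y v) (r v + if v ∈ c 0 then 1 else 0)) := by
          gcongr
          exact sum_draw_le hD hL hL0 (c 0) r y hy
      _ = (1 + Q / L) ^ (m + 1) * L⁻¹ ^ (∑ j, (c j).card) *
            ∏ v, rising (y v) (q v + ∑ j, if v ∈ c j then 1 else 0) := by
          have : ∀ v, r v + (if v ∈ c 0 then 1 else 0) =
              q v + ∑ j, if v ∈ c j then 1 else 0 := by
            intro v
            rw [Fin.sum_univ_succ, hr]
            ring
          simp only [this]
          rw [Fin.sum_univ_succ (fun j => (c j).card)]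
          ring
      -- Only the base of the m-th power changes: each draw's count of pending edges is replaced by
      -- the count at the start of the step.
      _ ≤ _ := by
          have : 0 < ∏ v, rising (y v) (q v + ∑ j, if v ∈ c j then 1 else 0) :=
            Finset.prod_pos fun v _ => rising_pos (hy0 v) _
          gcongr
          rw [hQ]
          refine Finset.sum_le_sum fun v _ => ?_
          rw [Fin.sum_univ_succ, hr]
          push_cast
          have : (0 : ℝ) ≤ if v ∈ c 0 then 1 else 0 := by positivity
          linarith

end Step

/-! ### Probability that a prescribed set of edges is present -/

section Constraints

variable {m n : ℕ} {δ : ℝ}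

/-- The edges prescribed by `C` are present in the history `h`: for `(i, j, v) ∈ C` with `i < n`,
the `j`-th edge added at step `i` is joined to `v`. -/
def Satisfies (C : Finset (ℕ × Fin m × ℕ)) (h : History m n) : Prop :=
  ∀ c ∈ C, ∀ hi : c.1 < n, (h ⟨c.1, hi⟩ c.2.1 : ℕ) = c.2.2

/-- The normalisation `(2 m + δ) t + δ` of the attachment probabilities at step `t`. -/
noncomputable def totalWeight (m : ℕ) (δ : ℝ) (t : ℕ) : ℝ := (2 * (m : ℝ) + δ) * (t : ℝ) + δ

theorem totalWeight_pos (hδ : 0 < δ) (t : ℕ) : 0 < totalWeight m δ t := by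
  unfold totalWeight
  positivity

theorem satisfies_extend (C : Finset (ℕ × Fin m × ℕ)) (h : History m n)
    (x : Fin m → Fin (n + 1)) :
    Satisfies C (extend h x) ↔
      Satisfies C h ∧ ∀ c ∈ C, c.1 = n → (x c.2.1 : ℕ) = c.2.2 := by
  constructor
  · intro H
    refine ⟨fun c hc hi => ?_, fun c hc hi => ?_⟩
    · have := H c hc (Nat.lt_succ_of_lt hi)
      rw [← this]
      exact congrArg (fun f => (f c.2.1 : ℕ)) (extend_castSucc h x ⟨c.1, hi⟩).symm
    · obtain ⟨i, j, v⟩ := c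
      obtain rfl : i = n := hi
      have := H _ hc (Nat.lt_succ_self _)
      rw [← this]
      exact congrArg (fun f => (f j : ℕ)) (extend_last h x).symm
  · rintro ⟨H1, H2⟩ ⟨i, j, v⟩ hc hi
    rcases Nat.lt_succ_iff_lt_or_eq.1 hi with hi' | rfl
    · rw [← H1 _ hc hi']
      exact congrArg (fun f => (f j : ℕ)) (extend_castSucc h x ⟨i, hi'⟩)
    · rw [← H2 _ hc rfl]
      exact congrArg (fun f => (f j : ℕ)) (extend_last h x)

/-- The number of edges prescribed by `C` to join a vertex added at step `n` or later to `v`. -/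
def pending (C : Finset (ℕ × Fin m × ℕ)) (n v : ℕ) : ℕ :=
  (C.filter fun c => n ≤ c.1 ∧ c.2.2 = v).card

/-- The targets prescribed by `C` for the `j`-th edge added at step `n`. -/
def targets (C : Finset (ℕ × Fin m × ℕ)) (n : ℕ) (j : Fin m) : Finset (Fin (n + 1)) :=
  Finset.univ.filter fun v => (n, j, (v : ℕ)) ∈ C

theorem forall_targets (C : Finset (ℕ × Fin m × ℕ)) (hC : ∀ c ∈ C, c.2.2 ≤ c.1)
    (x : Fin m → Fin (n + 1)) :
    (∀ c ∈ C, c.1 = n → (x c.2.1 : ℕ) = c.2.2) ↔ ∀ j, ∀ v ∈ targets C n j, x j = v := by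
  constructor
  · intro H j v hv
    exact Fin.ext (H (n, j, v) (Finset.mem_filter.1 hv).2 rfl)
  · rintro H ⟨i, j, v⟩ hc rfl
    have hv : v < i + 1 := Nat.lt_succ_of_le (hC _ hc)
    exact congrArg Fin.val (H j ⟨v, hv⟩ (by simpa [targets] using hc))

theorem pending_succ_add (C : Finset (ℕ × Fin m × ℕ)) (n : ℕ) (v : Fin (n + 1)) :
    pending C (n + 1) v + ∑ j, (if v ∈ targets C n j then 1 else 0) = pending C n v := by
  classical
  have h1 : C.filter (fun c => n ≤ c.1 ∧ c.2.2 = (v : ℕ)) =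
      C.filter (fun c => n + 1 ≤ c.1 ∧ c.2.2 = (v : ℕ)) ∪
        (Finset.univ.filter fun j => v ∈ targets C n j).image fun j => (n, j, (v : ℕ)) := by
    ext ⟨i, j, w⟩
    simp only [Finset.mem_filter, Finset.mem_union, Finset.mem_image, Finset.mem_univ, true_and,
      targets, Prod.mk.injEq]
    constructor
    · rintro ⟨hc, hi, rfl⟩
      rcases hi.eq_or_lt with rfl | hi
      · exact Or.inr ⟨j, hc, rfl, rfl, rfl⟩
      · exact Or.inl ⟨hc, hi, rfl⟩
    · rintro (⟨hc, hi, rfl⟩ | ⟨j, hc, rfl, rfl, rfl⟩)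
      · exact ⟨hc, by omega, rfl⟩
      · exact ⟨hc, le_rfl, rfl⟩
  rw [pending, pending, h1, Finset.card_union_of_disjoint, Finset.card_image_of_injective,
    Finset.card_filter fun j => v ∈ targets C n j]
  · intro a b hab
    simpa using hab
  · rw [Finset.disjoint_left]
    rintro ⟨i, j, w⟩ ha hb
    simp only [Finset.mem_filter, Finset.mem_image, Prod.mk.injEq] at ha hb
    obtain ⟨_, _, rfl, _⟩ := hb
    omega

theorem sum_card_targets (C : Finset (ℕ × Fin m × ℕ)) (hC : ∀ c ∈ C, c.2.2 ≤ c.1) (n : ℕ) :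
    ∑ j, (targets C n j).card = (C.filter fun c => c.1 = n).card := by
  classical
  rw [← Finset.card_sigma]
  refine Finset.card_bij (fun a _ => (n, a.1, (a.2 : ℕ))) ?_ ?_ ?_
  · rintro ⟨j, v⟩ h
    simpa [targets] using h
  · rintro ⟨j, v⟩ _ ⟨j', v'⟩ _ h
    simp only [Prod.mk.injEq, true_and] at h
    obtain ⟨rfl, h⟩ := h
    rw [Fin.ext h]
  · rintro ⟨i, j, v⟩ h
    obtain ⟨hc, rfl⟩ := Finset.mem_filter.1 h
    exact ⟨⟨j, ⟨v, Nat.lt_succ_of_le (hC _ hc)⟩⟩, by simpa [targets] using hc, rfl⟩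

theorem sum_pending (C : Finset (ℕ × Fin m × ℕ)) (n : ℕ) :
    ∑ v : Fin (n + 1), pending C n v = (C.filter fun c => c.2.2 ≤ n ∧ n ≤ c.1).card := by
  classical
  simp only [pending]
  rw [← Finset.card_sigma]
  refine Finset.card_bij (fun a _ => a.2) ?_ ?_ ?_
  · rintro ⟨v, c⟩ h
    simp only [Finset.mem_sigma, Finset.mem_filter, Finset.mem_univ, true_and] at h ⊢
    exact ⟨h.1, by have := v.isLt; omega, h.2.1⟩
  · rintro ⟨v, c⟩ h ⟨v', c'⟩ h' e
    simp only [Finset.mem_sigma, Finset.mem_filter, Finset.mem_univ, true_and] at h h' e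
    subst e
    obtain rfl : v = v' := Fin.ext (h.2.2.symm.trans h'.2.2)
    rfl
  · intro c h
    simp only [Finset.mem_filter] at h
    exact ⟨⟨⟨c.2.2, Nat.lt_succ_of_le h.2.1⟩, c⟩, by simp [h.1, h.2.2], rfl⟩

/-- The factor contributed by the prescribed edge `c` to the probability bound at step `t`. -/
noncomputable def stepFactor (δ K : ℝ) (t : ℕ) (c : ℕ × Fin m × ℕ) : ℝ :=
  (if c.2.2 ≤ t ∧ t ≤ c.1 then (1 + 1 / totalWeight m δ t) ^ m else 1) *
    (if c.1 = t then (totalWeight m δ t)⁻¹ else 1) * (if c.2.2 = t + 1 then K else 1)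

theorem prod_ite_eq_pow {ι : Type*} (s : Finset ι) (p : ι → Prop) [DecidablePred p] (a : ℝ) :
    ∏ c ∈ s, (if p c then a else 1) = a ^ (s.filter p).card := by
  rw [← Finset.prod_filter, Finset.prod_const]

theorem prod_stepFactor (C : Finset (ℕ × Fin m × ℕ)) (K : ℝ) (t : ℕ) :
    ∏ c ∈ C, stepFactor δ K t c =
      ((1 + 1 / totalWeight m δ t) ^ m) ^ (C.filter fun c => c.2.2 ≤ t ∧ t ≤ c.1).card *
        (totalWeight m δ t)⁻¹ ^ (C.filter fun c => c.1 = t).card *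
        K ^ (C.filter fun c => c.2.2 = t + 1).card := by
  simp only [stepFactor, Finset.prod_mul_distrib, prod_ite_eq_pow]

/-- The one-step inequality for the weighted indicator. Old vertices are handled by `sum_draws_le`;
the new vertex enters with degree m and contributes at most one factor K per edge prescribed to it.
-/
theorem sum_prod_attachProb_le (hδ : 0 < δ) (C : Finset (ℕ × Fin m × ℕ))
    (hC : ∀ c ∈ C, c.2.2 ≤ c.1) {K : ℝ} (hK : m + δ + C.card ≤ K) (h : History m n) :
    ∑ x : Fin m → Fin (n + 1), (∏ j, attachProb δ h (x j)) *
        ((if ∀ j, ∀ v ∈ targets C n j, x j = v then 1 else 0) *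
          ∏ v : Fin (n + 2), rising ((degree (extend h x) v : ℝ) + δ) (pending C (n + 1) v)) ≤
      (∏ v : Fin (n + 1), rising ((degree h v : ℝ) + δ) (pending C n v)) *
        ∏ c ∈ C, stepFactor δ K n c := by
  classical
  have hL0 := totalWeight_pos (m := m) hδ n
  have hD : ∀ v : Fin (n + 1), 0 < (degree h v : ℝ) + δ := fun v => by positivity
  have hL : ∑ v, ((degree h v : ℝ) + δ) = totalWeight m δ n := by
    have hs : (∑ v, (degree h v : ℝ)) = 2 * m * n := by exact_mod_cast sum_degree h
    rw [Finset.sum_add_distrib, hs, totalWeight]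
    simp
    ring
  have key := sum_draws_le hD hL hL0 m (targets C n) (fun v => pending C (n + 1) v)
    (fun v => (degree h v : ℝ) + δ) fun v => le_rfl
  simp only [pending_succ_add] at key
  rw [sum_card_targets C hC, ← Nat.cast_sum, sum_pending] at key
  set P := ∏ v : Fin (n + 1), rising ((degree h v : ℝ) + δ) (pending C n v)
  have hP : 0 < P := Finset.prod_pos fun v _ => rising_pos (hD v) _
  have hlast : rising ((m : ℝ) + δ) (pending C (n + 1) (n + 1)) ≤
      K ^ (C.filter fun c => c.2.2 = n + 1).card := by
    have : pending C (n + 1) (n + 1) = (C.filter fun c => c.2.2 = n + 1).card := by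
      rw [pending]
      congr 1
      refine Finset.filter_congr fun c hc => ?_
      have := hC c hc
      constructor
      · exact fun h => h.2
      · exact fun h => ⟨by omega, h⟩
    rw [this]
    refine rising_le_pow (by positivity) (le_trans ?_ hK)
    gcongr
    exact Finset.filter_subset _ _
  have hlast0 : 0 ≤ rising ((m : ℝ) + δ) (pending C (n + 1) (n + 1)) :=
    (rising_pos (by positivity) _).le
  calc _ = rising ((m : ℝ) + δ) (pending C (n + 1) (n + 1)) *
        ∑ x : Fin m → Fin (n + 1), (∏ j, ((degree h (x j) : ℝ) + δ) / totalWeight m δ n) *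
        ((if ∀ j, ∀ v ∈ targets C n j, x j = v then 1 else 0) *
        ∏ v : Fin (n + 1), rising (((degree h v : ℝ) + δ) +
          (∑ j, if x j = v then 1 else 0 : ℕ)) (pending C (n + 1) v)) := by
        rw [Finset.mul_sum]
        refine Finset.sum_congr rfl fun x _ => ?_
        rw [Fin.prod_univ_castSucc, degree_extend_last]
        simp only [degree_extend_castSucc, Fin.val_castSucc, Fin.val_last]
        have : ∀ v : Fin (n + 1), ((degree h v + ∑ j, if x j = v then 1 else 0 : ℕ) : ℝ) + δ =
            ((degree h v : ℝ) + δ) + (∑ j, if x j = v then 1 else 0 : ℕ) := by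
          intro v
          push_cast
          ring
        simp only [this]
        simp only [attachProb, totalWeight]
        ring
    _ ≤ K ^ (C.filter fun c => c.2.2 = n + 1).card *
        (((1 + 1 / totalWeight m δ n) ^ (C.filter fun c => c.2.2 ≤ n ∧ n ≤ c.1).card) ^ m *
          (totalWeight m δ n)⁻¹ ^ (C.filter fun c => c.1 = n).card * P) := by
        -- Bernoulli's inequality makes the growth factor a product over prescribed edges.
        have hb : 1 + ((C.filter fun c => c.2.2 ≤ n ∧ n ≤ c.1).card : ℝ) / totalWeight m δ n ≤
            (1 + 1 / totalWeight m δ n) ^ (C.filter fun c => c.2.2 ≤ n ∧ n ≤ c.1).card := by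
          have h0 : (0:ℝ) ≤ 1 / totalWeight m δ n := by positivity
          have := one_add_mul_le_pow (a := 1 / totalWeight m δ n) (by linarith)
            (C.filter fun c => c.2.2 ≤ n ∧ n ≤ c.1).card
          rwa [mul_one_div] at this
        refine mul_le_mul hlast ((le_of_eq (by congr!)).trans (key.trans ?_))
          (Finset.sum_nonneg fun x _ => ?_) (hlast0.trans hlast)
        · exact mul_le_mul_of_nonneg_right (mul_le_mul_of_nonneg_right
            (pow_le_pow_left₀ (by positivity) hb m) (by positivity)) hP.le
        · refine mul_nonneg (Finset.prod_nonneg fun j _ => ?_) (mul_nonneg ?_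
            (Finset.prod_nonneg fun v _ => (rising_pos ?_ _).le))
          · have := hD (x j)
            positivity
          · positivity
          · have := hD v
            positivity
    _ = _ := by
        rw [prod_stepFactor, ← pow_mul, ← pow_mul, mul_comm m]
        ring

-- Iterates the one-step bound. At time 0 only the vertex 0 exists, and its weight supplies one
-- factor K for each edge prescribed to it.
open Classical in
theorem expect_satisfies_mul_le (hδ : 0 < δ) (C : Finset (ℕ × Fin m × ℕ))
    (hC : ∀ c ∈ C, c.2.2 ≤ c.1) {K : ℝ} (hK : m + δ + C.card ≤ K) : ∀ n : ℕ,
    expect m hδ n (fun h => (if Satisfies C h then 1 else 0) *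
        ∏ v : Fin (n + 1), rising ((degree h v : ℝ) + δ) (pending C n v)) ≤
      ∏ c ∈ C, ((if c.2.2 = 0 then K else 1) * ∏ t ∈ Finset.range n, stepFactor δ K t c)
  | 0 => by
    have hK0 : 0 ≤ K := le_trans (by positivity) hK
    have h1 : pending C 0 0 = (C.filter fun c => c.2.2 = 0).card := by
      simp [pending]
    rw [expect_zero]
    simp only [Finset.range_zero, Finset.prod_empty, mul_one, prod_ite_eq_pow]
    have h2 : rising ((degree (fun i => i.elim0 : History m 0) 0 : ℝ) + δ) (pending C 0 0) ≤
        K ^ (C.filter fun c => c.2.2 = 0).card := by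
      rw [h1]
      refine rising_le_pow (by positivity) (le_trans ?_ hK)
      have h3 : degree (fun i => i.elim0 : History m 0) 0 = 0 := by simp [degree]
      have h4 : ((C.filter fun c => c.2.2 = 0).card : ℝ) ≤ C.card := by
        exact_mod_cast Finset.card_filter_le _ _
      have : (0 : ℝ) ≤ m := by positivity
      rw [h3]
      push_cast
      linarith
    have h3 : 0 ≤ rising ((degree (fun i => i.elim0 : History m 0) 0 : ℝ) + δ) (pending C 0 0) :=
      (rising_pos (by positivity) _).le
    simp only [Nat.reduceAdd, Fin.prod_univ_one]
    split_ifs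
    · rw [one_mul]
      exact h2
    · rw [zero_mul]
      exact h3.trans h2
  | n + 1 => by
    have hK0 : 0 ≤ K := le_trans (by positivity) hK
    have hL0 := totalWeight_pos (m := m) hδ n
    have hF0 : 0 ≤ ∏ c ∈ C, stepFactor δ K n c := by
      rw [prod_stepFactor]
      positivity
    rw [expect_succ]
    calc _ ≤ expect m hδ n (fun h => (∏ c ∈ C, stepFactor δ K n c) *
          ((if Satisfies C h then 1 else 0) *
          ∏ v : Fin (n + 1), rising ((degree h v : ℝ) + δ) (pending C n v))) := by
          refine expect_mono hδ fun h => ?_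
          by_cases hS : Satisfies C h
          · simp only [satisfies_extend, hS, true_and, if_true, forall_targets C hC]
            refine le_trans (le_of_eq ?_) ((sum_prod_attachProb_le hδ C hC hK h).trans
              (le_of_eq (by ring)))
            refine Finset.sum_congr rfl fun x _ => ?_
            congr
          · simp [satisfies_extend, hS]
      _ ≤ (∏ c ∈ C, stepFactor δ K n c) * ∏ c ∈ C,
          ((if c.2.2 = 0 then K else 1) * ∏ t ∈ Finset.range n, stepFactor δ K t c) := by
          rw [expect_const_mul]
          exact mul_le_mul_of_nonneg_left (expect_satisfies_mul_le hδ C hC hK n) hF0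
      _ = _ := by
          rw [← Finset.prod_mul_distrib]
          refine Finset.prod_congr rfl fun c _ => ?_
          rw [Finset.prod_range_succ]
          ring

/-- K occurs exactly once, at the birth of the older endpoint: in the initial term if that is the
vertex 0, otherwise at the step that creates it. -/
theorem prod_range_stepFactor {K : ℝ} (c : ℕ × Fin m × ℕ) (hc : c.2.2 ≤ c.1) (hn : c.1 < n) :
    (if c.2.2 = 0 then K else 1) * ∏ t ∈ Finset.range n, stepFactor δ K t c =
      K * ((∏ t ∈ Finset.Ico c.2.2 (c.1 + 1), (1 + 1 / totalWeight m δ t) ^ m) *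
        (totalWeight m δ c.1)⁻¹) := by
  obtain ⟨i, j, v⟩ := c
  simp only at hc hn
  have h1 : (Finset.range n).filter (fun t => v ≤ t ∧ t ≤ i) = Finset.Ico v (i + 1) := by
    ext t
    simp only [Finset.mem_filter, Finset.mem_range, Finset.mem_Ico]
    omega
  simp only [stepFactor, Finset.prod_mul_distrib]
  rw [← Finset.prod_filter, h1, Finset.prod_ite_eq, if_pos (Finset.mem_range.2 hn)]
  have h2 : (if v = 0 then K else 1) * ∏ t ∈ Finset.range n, (if v = t + 1 then K else 1) = K := by
    cases v with
    | zero => simp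
    | succ v =>
      simp only [Nat.add_right_cancel_iff]
      rw [Finset.prod_ite_eq, if_pos (Finset.mem_range.2 (by omega))]
      simp
  rw [mul_comm, mul_assoc, mul_comm _ (ite _ _ _), h2, mul_comm]

open Classical in
/-- Bound for the probability that all prescribed edges are present. -/
theorem expect_satisfies_le (hδ : 0 < δ) (C : Finset (ℕ × Fin m × ℕ))
    (hC : ∀ c ∈ C, c.2.2 ≤ c.1) {K : ℝ} (hK : m + δ + C.card ≤ K) {n : ℕ}
    (hn : ∀ c ∈ C, c.1 < n) :
    expect m hδ n (fun h => if Satisfies C h then 1 else 0) ≤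
      ∏ c ∈ C, (K * ((∏ t ∈ Finset.Ico c.2.2 (c.1 + 1), (1 + 1 / totalWeight m δ t) ^ m) *
        (totalWeight m δ c.1)⁻¹)) := by
  have key := expect_satisfies_mul_le hδ C hC hK n
  have hp : ∀ v : ℕ, pending C n v = 0 := by
    intro v
    rw [pending, Finset.card_eq_zero, Finset.filter_eq_empty_iff]
    intro c hc h
    have := hn c hc
    omega
  simp only [hp, rising, Finset.range_zero, Finset.prod_empty, Finset.prod_const_one,
    mul_one] at key
  refine key.trans (le_of_eq (Finset.prod_congr rfl fun c hc => ?_))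
  exact prod_range_stepFactor c (hC c hc) (hn c hc)

end Constraints

/-! ### Power-law cost of a single prescribed edge -/

section EdgeBound

variable {m : ℕ} {δ : ℝ}

theorem exp_one_div_le {x : ℝ} (hx : 1 < x) : Real.exp (1 / x) ≤ x / (x - 1) := by
  have h1 : 1 - 1 / x ≤ Real.exp (-(1 / x)) := Real.one_sub_le_exp_neg _
  have h2 : 0 < 1 - 1 / x := by
    rw [sub_pos, div_lt_one (by linarith)]
    exact hx
  rw [Real.exp_neg] at h1
  have h3 := inv_anti₀ h2 h1
  rw [inv_inv] at h3
  refine h3.trans (le_of_eq ?_)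
  field_simp

/-- `exp_one_div_le` makes the product telescope. The first factor is kept apart, because v + θ need
not exceed 1. -/
theorem prod_exp_one_div_le {θ : ℝ} (hθ : 0 < θ) (v d : ℕ) :
    ∏ t ∈ Finset.Ico v (v + d + 1), Real.exp (1 / (t + θ)) ≤
      Real.exp (1 / (v + θ)) * ((v + d + θ) / (v + θ)) := by
  induction d with
  | zero =>
    have : (v : ℝ) + θ ≠ 0 := by positivity
    simp [div_self this]
  | succ d ih =>
    rw [← add_assoc, Finset.prod_Ico_succ_top (by omega)]
    have hx : (1 : ℝ) < ((v + d + 1 : ℕ) : ℝ) + θ := by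
      push_cast
      have : (0 : ℝ) ≤ v := by positivity
      have : (0 : ℝ) ≤ d := by positivity
      linarith
    refine (mul_le_mul ih (exp_one_div_le hx) (Real.exp_pos _).le (by positivity)).trans
      (le_of_eq ?_)
    have h1 : ((v + d + 1 : ℕ) : ℝ) + θ - 1 = v + d + θ := by
      push_cast
      ring
    have h2 : (v : ℝ) + d + θ ≠ 0 := by positivity
    rw [h1, mul_assoc, div_mul_div_comm, mul_comm ((v : ℝ) + d + θ), mul_div_mul_right _ _ h2]
    push_cast
    ring

/-- Each prescribed edge between the vertex `i + 1` and the vertex `v ≤ i` costs a factor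
of order `(i + 1) ^ (β - 1) * v ^ (-β)`. -/
theorem exists_edge_bound (hδ : 0 < δ) : ∃ A : ℝ, 0 < A ∧ ∀ v i : ℕ, v ≤ i →
    (∏ t ∈ Finset.Ico v (i + 1), (1 + 1 / totalWeight m δ t) ^ m) * (totalWeight m δ i)⁻¹ ≤
      A * Real.exp (-((1 - m / (2 * m + δ)) * Real.log (i + 2) +
        m / (2 * m + δ) * Real.log (v + 1))) := by
  have hs : (0 : ℝ) < 2 * m + δ := by positivity
  set β : ℝ := m / (2 * m + δ) with hβ
  set θ : ℝ := δ / (2 * m + δ) with hθ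
  have hβ0 : 0 ≤ β := by positivity
  have hθ0 : 0 < θ := by positivity
  have hθ1 : θ ≤ 1 := by
    rw [hθ, div_le_one hs]
    have : (0 : ℝ) ≤ m := by positivity
    linarith
  have hw : ∀ t : ℕ, totalWeight m δ t = (2 * m + δ) * (t + θ) := by
    intro t
    rw [totalWeight, hθ]
    field_simp
  refine ⟨Real.exp (1 / θ * β) * θ⁻¹ ^ β * (2 / δ), by positivity, fun v i hvi => ?_⟩
  -- Since the total weight is (2m + δ)(t + θ), (1 + 1/L)^m ≤ exp(m/L) = exp(1/(t + θ))^β.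
  have h1 : ∏ t ∈ Finset.Ico v (i + 1), (1 + 1 / totalWeight m δ t) ^ m ≤
      (∏ t ∈ Finset.Ico v (i + 1), Real.exp (1 / (t + θ))) ^ β := by
    rw [← Real.finsetProd_rpow _ _ fun t _ => (Real.exp_pos _).le]
    refine Finset.prod_le_prod (fun t _ => ?_) fun t _ => ?_
    · have := totalWeight_pos (m := m) hδ t
      positivity
    · have h2 : 1 + 1 / totalWeight m δ t ≤ Real.exp (1 / totalWeight m δ t) := by
        rw [add_comm]
        exact Real.add_one_le_exp _
      have := totalWeight_pos (m := m) hδ t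
      refine (pow_le_pow_left₀ (by positivity) h2 m).trans (le_of_eq ?_)
      rw [← Real.exp_nat_mul, ← Real.exp_mul, hw, hβ]
      congr 1
      field_simp
  obtain ⟨d, rfl⟩ := Nat.exists_eq_add_of_le hvi
  have h2 := prod_exp_one_div_le hθ0 v d
  have h3 : Real.exp (1 / (v + θ)) * ((v + d + θ) / (v + θ)) ≤
      Real.exp (1 / θ) * (θ⁻¹ * (((v + d : ℕ) + 2) / (v + 1))) := by
    have hv : (0 : ℝ) ≤ v := by positivity
    have hd : (0 : ℝ) ≤ d := by positivity
    gcongr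
    · linarith
    · rw [inv_mul_eq_div, div_div, div_le_div_iff₀ (by positivity) (by positivity)]
      push_cast
      have : (v + 1 : ℝ) * θ ≤ v + θ := by nlinarith
      have h4 : (v + d + θ : ℝ) ≤ v + d + 2 := by linarith
      exact mul_le_mul h4 this (by positivity) (by positivity)
  have h4 : (totalWeight m δ (v + d))⁻¹ ≤ 2 / δ * ((v + d : ℕ) + 2 : ℝ)⁻¹ := by
    rw [← div_eq_mul_inv, div_div, inv_eq_one_div, div_le_div_iff₀ (totalWeight_pos hδ _)
      (by positivity), totalWeight]
    have : (0 : ℝ) ≤ (2 * m) * (v + d : ℕ) := by positivity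
    have : (0 : ℝ) ≤ δ * (v + d : ℕ) := by positivity
    nlinarith
  have hd2 : (0 : ℝ) < (v + d : ℕ) + 2 := by positivity
  have hv1 : (0 : ℝ) < v + 1 := by positivity
  calc _ ≤ (Real.exp (1 / θ) * (θ⁻¹ * (((v + d : ℕ) + 2) / (v + 1)))) ^ β *
        (2 / δ * ((v + d : ℕ) + 2 : ℝ)⁻¹) := by
        refine mul_le_mul (h1.trans (Real.rpow_le_rpow (Finset.prod_nonneg fun t _ =>
          (Real.exp_pos _).le) (h2.trans h3) hβ0)) h4 ?_ (by positivity)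
        exact inv_nonneg.2 (totalWeight_pos hδ _).le
    _ = _ := by
        rw [Real.mul_rpow (by positivity) (by positivity),
          Real.mul_rpow (by positivity) (by positivity), Real.exp_mul,
          Real.rpow_def_of_pos (div_pos hd2 hv1), Real.log_div hd2.ne' hv1.ne',
          ← Real.exp_log (inv_pos.2 hd2), Real.log_inv]
        have : ∀ a b c d e : ℝ, a * (b * c) * (d * e) = a * b * d * (c * e) := by
          intros; ring
        rw [this, ← Real.exp_add]
        congr 2
        ring

end EdgeBound

/-! ### Exponents of the vertices of `H` and their tail sums -/

section Tails

variable {W : Type*} [Fintype W] {k : ℕ} (H : SimpleGraph W) [DecidableRel H.Adj] (π : W ≃ Fin k)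

/-- The edges of `H`, as pairs whose first component comes first in the ordering `π`. -/
def orderedEdges : Finset (W × W) := Finset.univ.filter fun p => H.Adj p.1 p.2 ∧ π p.1 < π p.2

theorem sum_orderedEdges_fst (f : W → ℝ) :
    ∑ p ∈ orderedEdges H π, f p.1 = ∑ w, (inDeg H π w : ℝ) * f w := by
  rw [orderedEdges, Finset.sum_filter, Fintype.sum_prod_type]
  refine Finset.sum_congr rfl fun w _ => ?_
  rw [inDeg, Finset.card_filter, Nat.cast_sum, Finset.sum_mul]
  refine Finset.sum_congr rfl fun u _ => ?_
  simp

theorem sum_orderedEdges_snd (f : W → ℝ) :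
    ∑ p ∈ orderedEdges H π, f p.2 = ∑ w, (outDeg H π w : ℝ) * f w := by
  rw [orderedEdges, Finset.sum_filter, Fintype.sum_prod_type_right]
  refine Finset.sum_congr rfl fun w _ => ?_
  rw [outDeg, Finset.card_filter, Nat.cast_sum, Finset.sum_mul]
  refine Finset.sum_congr rfl fun u _ => ?_
  simp [H.adj_comm]

theorem inDeg_add_outDeg (v : W) : inDeg H π v + outDeg H π v = H.degree v := by
  classical
  rw [inDeg, outDeg, ← Finset.card_union_of_disjoint, ← SimpleGraph.card_neighborFinset_eq_degree]
  · congr 1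
    ext u
    simp only [Finset.mem_union, Finset.mem_filter, Finset.mem_univ, true_and,
      SimpleGraph.mem_neighborFinset, ← and_or_left, and_iff_left_iff_imp]
    intro h
    exact lt_or_gt_of_ne fun e => h.ne (π.injective e)
  · rw [Finset.disjoint_filter]
    exact fun u _ h1 h2 => lt_asymm h1.2 h2.2

/-- The exponent of the label of `w` in the probability bound for an ordered copy of `H`. -/
noncomputable def vertexExponent (β : ℝ) (w : W) : ℝ :=
  β * (inDeg H π w : ℝ) + (1 - β) * (outDeg H π w : ℝ)

theorem card_filter_le_val (s : ℕ) (hs : s ≤ k) :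
    (Finset.univ.filter fun i : Fin k => s ≤ (i : ℕ)).card = k - s := by
  have h := Fin.card_filter_val_lt (n := k) (m := s)
  have h2 := Finset.card_filter_add_card_filter_not (s := (Finset.univ : Finset (Fin k)))
    (fun i => (i : ℕ) < s)
  simp only [not_lt, Finset.card_univ, Fintype.card_fin] at h2
  omega

variable {H}

/-- Let A and B count the edges whose earlier, respectively later, endpoint lies in the tail. The
exponent sum is βA + (1-β)B = (A+B)/2 + (1/2-β)(B-A). For s = 0 the extra edge gives A + B ≥ 2(k+1).
For s > 0 the minimum degree gives A + B ≥ 2(k-s), and connectivity provides an edge crossing into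
the tail, so B - A ≥ 1. -/
theorem tail_sum_vertexExponent (hconn : H.Connected) (hdeg : ∀ v : W, 2 ≤ H.degree v)
    (hedges : k + 1 ≤ H.edgeFinset.card) {β : ℝ} (hβ0 : 0 ≤ β) (hβ : β < 1 / 2)
    {s : ℕ} (hs : s < k) :
    ((k : ℝ) - s) + (1 / 2 - β) ≤
      ∑ i ∈ Finset.univ.filter (fun i : Fin k => s ≤ (i : ℕ)),
        vertexExponent H π β (π.symm i) := by
  set f : W → ℝ := fun w => if s ≤ (π w : ℕ) then 1 else 0 with hf
  have hsum : ∀ g : W → ℝ, ∑ i ∈ Finset.univ.filter (fun i : Fin k => s ≤ (i : ℕ)),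
      g (π.symm i) = ∑ w, g w * f w := by
    intro g
    rw [Finset.sum_filter, ← π.sum_comp]
    refine Finset.sum_congr rfl fun w _ => ?_
    simp [hf]
  set A := ∑ p ∈ orderedEdges H π, f p.1 with hA
  set B := ∑ p ∈ orderedEdges H π, f p.2 with hB
  have hcard : ∑ w, f w = (k : ℝ) - s := by
    have := hsum fun _ => 1
    simp only [Finset.sum_const, card_filter_le_val s hs.le, nsmul_eq_mul, mul_one, one_mul,
      Nat.cast_sub hs.le] at this
    exact this.symm
  have hAB : A + B = ∑ w, (H.degree w : ℝ) * f w := by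
    rw [hA, hB, sum_orderedEdges_fst, sum_orderedEdges_snd, ← Finset.sum_add_distrib]
    refine Finset.sum_congr rfl fun w _ => ?_
    rw [← inDeg_add_outDeg H π w]
    push_cast
    ring
  have hmono : ∀ p ∈ orderedEdges H π, f p.1 ≤ f p.2 := by
    intro p hp
    have h1 : (π p.1 : ℕ) < π p.2 := (Finset.mem_filter.1 hp).2.2
    simp only [hf]
    split_ifs with h2 h3 h3
    · exact le_rfl
    · omega
    · exact zero_le_one
    · exact le_rfl
  have hle : A ≤ B := Finset.sum_le_sum hmono
  have htot : ∑ w, vertexExponent H π β w * f w = (A + B) / 2 + (1 / 2 - β) * (B - A) := by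
    have h1 : ∑ w, vertexExponent H π β w * f w = β * A + (1 - β) * B := by
      rw [hA, hB, sum_orderedEdges_fst, sum_orderedEdges_snd, Finset.mul_sum, Finset.mul_sum,
        ← Finset.sum_add_distrib]
      refine Finset.sum_congr rfl fun w _ => ?_
      rw [vertexExponent]
      ring
    rw [h1]
    ring
  rw [hsum, htot]
  rcases Nat.eq_zero_or_pos s with rfl | hs0
  · have h1 : A + B = 2 * H.edgeFinset.card := by
      rw [hAB]
      simp only [hf, Nat.zero_le, if_true, mul_one]
      exact_mod_cast H.sum_degrees_eq_twice_card_edges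
    have h2 : (k : ℝ) + 1 ≤ H.edgeFinset.card := by exact_mod_cast hedges
    have h3 : 0 ≤ (1 / 2 - β) * (B - A) := mul_nonneg (by linarith) (by linarith)
    rw [h1]
    push_cast
    linarith
  · have h1 : 2 * ((k : ℝ) - s) ≤ A + B := by
      rw [hAB, ← hcard, Finset.mul_sum]
      refine Finset.sum_le_sum fun w _ => ?_
      have : (2 : ℝ) ≤ H.degree w := by exact_mod_cast hdeg w
      have : 0 ≤ f w := by simp only [hf]; positivity
      gcongr
    have h2 : A + 1 ≤ B := by
      obtain ⟨p⟩ := hconn.preconnected (π.symm ⟨0, by omega⟩) (π.symm ⟨s, hs⟩)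
      obtain ⟨d, -, hd1, hd2⟩ := p.exists_boundary_dart {w | (π w : ℕ) < s} (by simpa using hs0)
        (by simp)
      simp only [Set.mem_ofPred_eq, not_lt] at hd1 hd2
      have hmem : (d.fst, d.snd) ∈ orderedEdges H π := by
        refine Finset.mem_filter.2 ⟨Finset.mem_univ _, d.adj, ?_⟩
        exact Fin.lt_def.2 (hd1.trans_le hd2)
      have h3 := Finset.single_le_sum (f := fun p => f p.2 - f p.1)
        (fun p hp => sub_nonneg.2 (hmono p hp)) hmem
      rw [Finset.sum_sub_distrib] at h3
      have h4 : f d.fst = 0 := if_neg (by omega)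
      have h5 : f d.snd = 1 := if_pos hd2
      simp only [h4, h5] at h3
      linarith
    nlinarith

/-- Abel summation: the sum is a combination of the tail sums of b with coefficients l 0 and the
increments of l, all nonnegative. -/
theorem sum_mul_nonneg_of_tails : ∀ {k : ℕ} (b l : Fin k → ℝ), Monotone l → (∀ i, 0 ≤ l i) →
    (∀ s < k, 0 ≤ ∑ i ∈ Finset.univ.filter (fun i : Fin k => s ≤ (i : ℕ)), b i) →
    0 ≤ ∑ i, b i * l i := by
  intro k b l hl hl0 hb
  -- Downward induction on s, with j the number of positions after s.
  have key : ∀ j : ℕ, ∀ s : ℕ, ∀ hs : s < k, k = s + 1 + j →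
      l ⟨s, hs⟩ * ∑ i ∈ Finset.univ.filter (fun i : Fin k => s ≤ (i : ℕ)), b i ≤
        ∑ i ∈ Finset.univ.filter (fun i : Fin k => s ≤ (i : ℕ)), b i * l i := by
    have hsplit : ∀ s : ℕ, ∀ hs : s < k, Finset.univ.filter (fun i : Fin k => s ≤ (i : ℕ)) =
        insert ⟨s, hs⟩ (Finset.univ.filter fun i : Fin k => s + 1 ≤ (i : ℕ)) := by
      intro s hs
      ext i
      simp only [Finset.mem_filter, Finset.mem_univ, true_and, Finset.mem_insert, Fin.ext_iff]
      omega
    have hnot : ∀ s : ℕ, ∀ hs : s < k,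
        (⟨s, hs⟩ : Fin k) ∉ Finset.univ.filter fun i : Fin k => s + 1 ≤ (i : ℕ) := by
      intro s hs
      simp
    intro j
    induction j with
    | zero =>
      intro s hs hk
      have he : Finset.univ.filter (fun i : Fin k => s + 1 ≤ (i : ℕ)) = ∅ := by
        rw [Finset.filter_eq_empty_iff]
        intro i _
        have := i.isLt
        omega
      rw [hsplit s hs, he]
      simp [mul_comm]
    | succ j ih =>
      intro s hs hk
      have hs' : s + 1 < k := by omega
      have h1 := ih (s + 1) hs' (by omega)
      have h2 : l ⟨s, hs⟩ ≤ l ⟨s + 1, hs'⟩ := hl (Fin.le_def.2 (Nat.le_succ s))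
      have h3 := mul_le_mul_of_nonneg_right h2 (hb (s + 1) hs')
      rw [hsplit s hs, Finset.sum_insert (hnot s hs), Finset.sum_insert (hnot s hs)]
      linarith
  rcases Nat.eq_zero_or_pos k with rfl | hk
  · simp
  · have h1 := key (k - 1) 0 hk (by omega)
    have h2 := mul_nonneg (hl0 ⟨0, hk⟩) (hb 0 hk)
    simpa using h2.trans h1

/-- Spreads the surplus 1/2 - β of every tail evenly over the k vertices; a tail has at most k of
them, so it can pay. -/
theorem le_sum_vertexExponent_mul (hconn : H.Connected) (hdeg : ∀ v : W, 2 ≤ H.degree v)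
    (hedges : k + 1 ≤ H.edgeFinset.card) {β : ℝ} (hβ0 : 0 ≤ β) (hβ : β < 1 / 2)
    (l : W → ℝ) (hl : ∀ u v, π u < π v → l u ≤ l v) (hl0 : ∀ w, 0 ≤ l w) :
    (1 + (1 / 2 - β) / k) * ∑ w, l w ≤ ∑ w, vertexExponent H π β w * l w := by
  have h := sum_mul_nonneg_of_tails
    (fun i => vertexExponent H π β (π.symm i) - (1 + (1 / 2 - β) / k)) (fun i => l (π.symm i))
    (fun i j hij => by
      rcases hij.eq_or_lt with rfl | hij
      · exact le_rfl
      · exact hl _ _ (by simpa using hij)) (fun i => hl0 _) fun s hs => by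
      have h1 := tail_sum_vertexExponent π hconn hdeg hedges hβ0 hβ hs
      rw [Finset.sum_sub_distrib, Finset.sum_const, card_filter_le_val s hs.le, nsmul_eq_mul,
        Nat.cast_sub hs.le, sub_nonneg]
      refine le_trans ?_ h1
      have hk : (0 : ℝ) < k := by exact_mod_cast (Nat.zero_le s).trans_lt hs
      have hs0 : (0 : ℝ) ≤ s := by positivity
      have h2 : ((k : ℝ) - s) * ((1 / 2 - β) / k) ≤ 1 / 2 - β := by
        rw [mul_div_assoc', div_le_iff₀ hk]
        nlinarith
      linarith
  rw [π.symm.sum_comp fun w => (vertexExponent H π β w - (1 + (1 / 2 - β) / k)) * l w] at h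
  simp only [sub_mul, Finset.sum_sub_distrib, ← Finset.mul_sum] at h
  linarith

theorem one_div_tau_sub_one {m : ℕ} (hm : 0 < m) (δ : ℝ) :
    1 / (tau m δ - 1) = m / (2 * m + δ) := by
  have : (0 : ℝ) < m := by exact_mod_cast hm
  rw [tau]
  have h : (3 : ℝ) + δ / m - 1 = (2 * m + δ) / m := by
    field_simp
    ring
  rw [h, one_div_div]

theorem exponentAt_last (m : ℕ) (δ : ℝ) : exponentAt H π m δ k = -(k : ℝ) := by
  have : Finset.univ.filter (fun i : Fin k => k ≤ (i : ℕ)) = ∅ := by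
    rw [Finset.filter_eq_empty_iff]
    intro i _
    exact not_le.2 i.isLt
  rw [exponentAt, this, Finset.sum_empty, sub_zero]

theorem beta_lt_half {m : ℕ} {δ : ℝ} (hδ : 0 < δ) : (m : ℝ) / (2 * m + δ) < 1 / 2 := by
  rw [div_lt_div_iff₀ (by positivity) two_pos]
  linarith

theorem exponentAt_lt (hconn : H.Connected) (hdeg : ∀ v : W, 2 ≤ H.degree v)
    (hedges : k + 1 ≤ H.edgeFinset.card) {m : ℕ} (hm : 0 < m) {δ : ℝ} (hδ : 0 < δ)
    {s : ℕ} (hs : s < k) : exponentAt H π m δ s < -(k : ℝ) := by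
  have hβ := beta_lt_half (m := m) hδ
  have h := tail_sum_vertexExponent π hconn hdeg hedges (by positivity) hβ hs
  rw [exponentAt, one_div_tau_sub_one hm δ]
  simp only [vertexExponent] at h
  linarith

theorem exponent_eq (hconn : H.Connected) (hdeg : ∀ v : W, 2 ≤ H.degree v)
    (hedges : k + 1 ≤ H.edgeFinset.card) {m : ℕ} (hm : 0 < m) {δ : ℝ} (hδ : 0 < δ) :
    exponent H π m δ = -(k : ℝ) := by
  refine le_antisymm (Finset.sup'_le _ _ fun s hs => ?_) ?_
  · rcases Nat.lt_succ_iff_lt_or_eq.1 (Finset.mem_range.1 hs) with hs | rfl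
    · exact (exponentAt_lt π hconn hdeg hedges hm hδ hs).le
    · exact (exponentAt_last π m δ).le
  · rw [← exponentAt_last (H := H) π m δ]
    exact Finset.le_sup' (exponentAt H π m δ) (Finset.mem_range.2 (Nat.lt_succ_self k))

end Tails

/-! ### Comparison of both subgraph counts with embeddings -/

section Embeddings

variable {m n : ℕ} {W : Type*} {k : ℕ}

/-- The vertices `φ w` of `G_n` together with the edges with labels `c (a, b)` between them form a
copy of `H` that respects `π`. -/
def IsEmbedding (H : SimpleGraph W) (π : W ≃ Fin k) (h : History m n)
    (p : (W → Fin (n + 1)) × (W × W → Fin m)) : Prop :=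
  (∀ u v, π u < π v ↔ p.1 u < p.1 v) ∧
    ∀ a b, H.Adj a b → π a < π b →
      ∃ i : Fin n, p.1 b = i.succ ∧ oldEnd h (i, p.2 (a, b)) = p.1 a

theorem oldEnd_lt_newEnd (h : History m n) (e : Fin n × Fin m) : oldEnd h e < newEnd e := by
  have := (h e.1 e.2).isLt
  simpa [oldEnd, newEnd, Fin.lt_def] using this

theorem ends_eq_iff (h : History m n) (e : Fin n × Fin m) {a b : Fin (n + 1)} (hab : a < b) :
    ends h e = s(a, b) ↔ b = e.1.succ ∧ oldEnd h e = a := by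
  have h1 := oldEnd_lt_newEnd h e
  rw [ends, Sym2.eq_iff]
  constructor
  · rintro (⟨rfl, rfl⟩ | ⟨h2, h3⟩)
    · exact absurd h1 (lt_asymm hab)
    · exact ⟨h2.symm, h3⟩
  · rintro ⟨h2, h3⟩
    exact Or.inr ⟨h2.symm, h3⟩

theorem injective_of_lt_iff {π : W ≃ Fin k} {φ : W → Fin (n + 1)}
    (h : ∀ u v, π u < π v ↔ φ u < φ v) : Function.Injective φ := by
  intro u v e
  by_contra hne
  rcases lt_or_gt_of_ne fun e => hne (π.injective e) with h1 | h1
  · exact ((h u v).1 h1).ne e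
  · exact ((h v u).1 h1).ne' e

theorem exists_isEmbedding {H : SimpleGraph W} {π : W ≃ Fin k} {h : History m n}
    (hm : 0 < m) {φ : W → Fin (n + 1)} (hφ : ∀ u v, π u < π v ↔ φ u < φ v)
    (hH : ∀ a b, H.Adj a b → ∃ e, ends h e = s(φ a, φ b)) :
    ∃ c, IsEmbedding H π h (φ, c) := by
  classical
  choose e he using hH
  refine ⟨fun p => if hp : H.Adj p.1 p.2 then (e p.1 p.2 hp).2 else ⟨0, hm⟩, hφ,
    fun a b hab hlt => ?_⟩
  have := (ends_eq_iff h (e a b hab) ((hφ a b).1 hlt)).1 (he a b hab)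
  exact ⟨(e a b hab).1, this.1, by simpa [hab] using this.2⟩

theorem simple_adj_iff (h : History m n) {a b : Fin (n + 1)} :
    (simple h).Adj a b ↔ ∃ e, ends h e = s(a, b) := by
  rw [simple, SimpleGraph.fromEdgeSet_adj, Set.mem_range, and_iff_left_iff_imp]
  rintro ⟨e, he⟩ rfl
  have h1 := oldEnd_lt_newEnd h e
  rw [ends, Sym2.eq_iff] at he
  rcases he with ⟨h2, h3⟩ | ⟨h2, h3⟩ <;> exact h1.ne (h3.trans h2.symm)

/-- Attach to each copy one embedding from which its vertex and edge sets can be read off; the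
assignment is then injective. -/
theorem simpleCopies_le {H : SimpleGraph W} {π : W ≃ Fin k} [Finite W] (hm : 0 < m)
    (h : History m n) : simpleCopies H π h ≤ {p | IsEmbedding H π h p}.ncard := by
  classical
  have key : ∀ G' ∈ {G' : (simple h).Subgraph |
      ∃ φ : H ≃g G'.coe, ∀ u v : W, π u < π v ↔ (φ u).1 < (φ v).1}, ∃ p, IsEmbedding H π h p ∧
      G'.verts = Set.range p.1 ∧
      ∀ x y, G'.Adj x y ↔ ∃ a b, H.Adj a b ∧ p.1 a = x ∧ p.1 b = y := by
    rintro G' ⟨φ, hφ⟩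
    obtain ⟨c, hc⟩ := exists_isEmbedding (H := H) (h := h) hm hφ fun a b hab => by
      rw [← simple_adj_iff]
      have : G'.coe.Adj (φ a) (φ b) := φ.map_adj_iff.2 hab
      exact G'.adj_sub this
    refine ⟨_, hc, ?_, fun x y => ?_⟩
    · ext x
      constructor
      · intro hx
        exact ⟨φ.symm ⟨x, hx⟩, by simp⟩
      · rintro ⟨w, rfl⟩
        exact (φ w).2
    · constructor
      · intro hxy
        refine ⟨φ.symm ⟨x, G'.edge_vert hxy⟩, φ.symm ⟨y, G'.edge_vert hxy.symm⟩, ?_, by simp,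
          by simp⟩
        rw [φ.symm.map_adj_iff]
        exact hxy
      · rintro ⟨a, b, hab, rfl, rfl⟩
        exact φ.map_adj_iff.2 hab
  have : Nonempty (Fin m) := ⟨⟨0, hm⟩⟩
  choose! f hf using key
  refine Set.ncard_le_ncard_of_injOn f (fun G' hG => (hf G' hG).1) ?_ (Set.toFinite _)
  intro G₁ h1 G₂ h2 e
  obtain ⟨-, hv1, ha1⟩ := hf G₁ h1
  obtain ⟨-, hv2, ha2⟩ := hf G₂ h2
  refine SimpleGraph.Subgraph.ext ?_ ?_
  · rw [hv1, hv2, e]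
  · ext x y
    rw [ha1, ha2, e]

theorem copies_le {H : SimpleGraph W} {π : W ≃ Fin k} [Finite W] (hm : 0 < m)
    (h : History m n) : copies H π h ≤ {p | IsEmbedding H π h p}.ncard := by
  classical
  have key : ∀ p ∈ {p : Finset (Fin (n + 1)) × Finset (Fin n × Fin m) | IsCopy H π h p.1 p.2},
      ∃ q, IsEmbedding H π h q ∧ (p.1 : Set (Fin (n + 1))) = Set.range q.1 ∧
      ∀ e, e ∈ p.2 ↔ ∃ a b, H.Adj a b ∧ π a < π b ∧ q.1 b = e.1.succ ∧ q.2 (a, b) = e.2 := by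
    rintro ⟨V, E⟩ ⟨φ, ψ, hψ, hφ⟩
    -- The label 0 on non-adjacent pairs is a dummy value; only labels of edges are read back.
    set c : W × W → Fin m := fun p =>
      if hp : H.Adj p.1 p.2 then (ψ ⟨s(p.1, p.2), hp⟩).1.2 else ⟨0, hm⟩ with hc
    have hkey : ∀ a b (hab : H.Adj a b), π a < π b →
        (φ b).1 = (ψ ⟨s(a, b), hab⟩).1.1.succ ∧ oldEnd h (ψ ⟨s(a, b), hab⟩).1 = (φ a).1 := by
      intro a b hab hlt
      exact (ends_eq_iff h _ ((hφ a b).1 hlt)).1 (hψ ⟨s(a, b), hab⟩)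
    refine ⟨(fun w => (φ w).1, c), ⟨hφ, fun a b hab hlt => ?_⟩, ?_, fun e => ?_⟩
    · obtain ⟨h1, h2⟩ := hkey a b hab hlt
      exact ⟨_, h1, by simpa [hc, hab] using h2⟩
    · ext x
      constructor
      · intro hx
        exact ⟨φ.symm ⟨x, hx⟩, by simp⟩
      · rintro ⟨w, rfl⟩
        exact (φ w).2
    · constructor
      · intro he
        obtain ⟨⟨z, hz⟩, hze⟩ := ψ.surjective ⟨e, he⟩
        have : ∃ a b, z = s(a, b) ∧ π a < π b := by
          induction z using Sym2.ind with
          | _ a b =>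
            have hne : π a ≠ π b := fun h => (SimpleGraph.Adj.ne hz) (π.injective h)
            rcases lt_or_gt_of_ne hne with h1 | h1
            · exact ⟨a, b, rfl, h1⟩
            · exact ⟨b, a, Sym2.eq_swap, h1⟩
        obtain ⟨a, b, rfl, hlt⟩ := this
        have hab : H.Adj a b := hz
        have h1 := hkey a b hab hlt
        rw [hze] at h1
        refine ⟨a, b, hab, hlt, h1.1, ?_⟩
        simp only [hc, hab, dif_pos]
        rw [hze]
      · rintro ⟨a, b, hab, hlt, h1, h2⟩
        have h3 := (hkey a b hab hlt).1
        simp only [hc, hab, dif_pos] at h2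
        have : e = (ψ ⟨s(a, b), hab⟩).1 :=
          Prod.ext (Fin.succ_injective _ (h1.symm.trans h3)) h2.symm
        rw [this]
        exact (ψ ⟨s(a, b), hab⟩).2
  have : Nonempty (Fin m) := ⟨⟨0, hm⟩⟩
  choose! f hf using key
  refine Set.ncard_le_ncard_of_injOn f (fun G' hG => (hf G' hG).1) ?_ (Set.toFinite _)
  intro p₁ h1 p₂ h2 e
  obtain ⟨-, hv1, ha1⟩ := hf p₁ h1
  obtain ⟨-, hv2, ha2⟩ := hf p₂ h2
  refine Prod.ext (Finset.coe_injective ?_) ?_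
  · rw [hv1, hv2, e]
  · ext x
    rw [ha1, ha2, e]

theorem one_le_simpleCopies {H : SimpleGraph W} {π : W ≃ Fin k} {h : History m n}
    {p : (W → Fin (n + 1)) × (W × W → Fin m)} (hp : IsEmbedding H π h p) :
    1 ≤ simpleCopies H π h := by
  classical
  rw [Nat.one_le_iff_ne_zero, simpleCopies, Ne, Set.ncard_eq_zero (Set.toFinite _),
    ← Ne, ← Set.nonempty_iff_ne_empty]
  have hinj := injective_of_lt_iff hp.1
  let F : H.Copy (simple h) :=
    ⟨⟨p.1, fun {a b} hab => by
      rw [simple_adj_iff]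
      have hne : π a ≠ π b := fun h => hab.ne (π.injective h)
      rcases lt_or_gt_of_ne hne with h1 | h1
      · obtain ⟨i, h2, h3⟩ := hp.2 a b hab h1
        exact ⟨(i, p.2 (a, b)), (ends_eq_iff h _ ((hp.1 a b).1 h1)).2 ⟨h2, h3⟩⟩
      · obtain ⟨i, h2, h3⟩ := hp.2 b a hab.symm h1
        rw [Sym2.eq_swap]
        exact ⟨(i, p.2 (b, a)), (ends_eq_iff h _ ((hp.1 b a).1 h1)).2 ⟨h2, h3⟩⟩⟩, hinj⟩
  exact ⟨F.toSubgraph, F.isoToSubgraph, hp.1⟩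

theorem one_le_copies {H : SimpleGraph W} {π : W ≃ Fin k} {h : History m n} [Finite W]
    {p : (W → Fin (n + 1)) × (W × W → Fin m)} (hp : IsEmbedding H π h p) :
    1 ≤ copies H π h := by
  classical
  have := Fintype.ofFinite W
  rw [Nat.one_le_iff_ne_zero, copies, Ne, Set.ncard_eq_zero (Set.toFinite _),
    ← Ne, ← Set.nonempty_iff_ne_empty]
  have hinj := injective_of_lt_iff hp.1
  have hex : ∀ z : H.edgeSet, ∃ e, ends h e = Sym2.map p.1 z.1 := by
    rintro ⟨z, hz⟩
    induction z using Sym2.ind with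
    | _ a b =>
      have hab : H.Adj a b := hz
      have hne : π a ≠ π b := fun h => hab.ne (π.injective h)
      rw [Sym2.map_mk]
      rcases lt_or_gt_of_ne hne with h1 | h1
      · obtain ⟨i, h2, h3⟩ := hp.2 a b hab h1
        exact ⟨(i, p.2 (a, b)), (ends_eq_iff h _ ((hp.1 a b).1 h1)).2 ⟨h2, h3⟩⟩
      · obtain ⟨i, h2, h3⟩ := hp.2 b a hab.symm h1
        rw [Sym2.eq_swap]
        exact ⟨(i, p.2 (b, a)), (ends_eq_iff h _ ((hp.1 b a).1 h1)).2 ⟨h2, h3⟩⟩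
  choose g hg using hex
  have hginj : Function.Injective g := by
    intro z z' e
    have := (hg z).symm.trans ((congrArg (ends h) e).trans (hg z'))
    exact Subtype.ext (Sym2.map.injective hinj this)
  refine ⟨(Finset.univ.image p.1, Finset.univ.image g), ?_⟩
  refine ⟨(Equiv.ofInjective p.1 hinj).trans (Equiv.setCongr (by simp)),
    (Equiv.ofInjective g hginj).trans (Equiv.setCongr (by simp)), fun e => ?_, fun u v => ?_⟩
  · exact hg e
  · exact hp.1 u v

theorem IsEmbedding.extend {π : W ≃ Fin k} {n : ℕ} {h : History m n}
    {p : (W → Fin (n + 1)) × (W × W → Fin m)} (hp : IsEmbedding H π h p)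
    (x : Fin m → Fin (n + 1)) :
    IsEmbedding H π (extend h x) (fun w => (p.1 w).castSucc, p.2) := by
  refine ⟨fun u v => by simpa using hp.1 u v, fun a b hab hlt => ?_⟩
  obtain ⟨i, h1, h2⟩ := hp.2 a b hab hlt
  refine ⟨i.castSucc, congrArg Fin.castSucc h1, ?_⟩
  simp only [← h2, oldEnd, extend_castSucc]
  rfl

end Embeddings

/-! ### First moment bound and lower bound -/

section Bounds

variable {m : ℕ} {δ : ℝ} {W : Type*} [Fintype W] {k : ℕ} {H : SimpleGraph W} [DecidableRel H.Adj]

/-- The edges that have to be present for `(φ, c)` to be an embedding of `H`. -/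
def constraints (H : SimpleGraph W) [DecidableRel H.Adj] (π : W ≃ Fin k) {n : ℕ}
    (φ : W → Fin (n + 1)) (c : W × W → Fin m) : Finset (ℕ × Fin m × ℕ) :=
  (orderedEdges H π).image fun p => ((φ p.2 : ℕ) - 1, c p, (φ p.1 : ℕ))

theorem IsEmbedding.satisfies {π : W ≃ Fin k} {n : ℕ} {h : History m n}
    {p : (W → Fin (n + 1)) × (W × W → Fin m)} (hp : IsEmbedding H π h p) :
    Satisfies (constraints H π p.1 p.2) h := by
  intro d hd hi
  obtain ⟨⟨a, b⟩, hab, rfl⟩ := Finset.mem_image.1 hd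
  simp only [orderedEdges, Finset.mem_filter, Finset.mem_univ, true_and] at hab
  obtain ⟨i, h1, h2⟩ := hp.2 a b hab.1 hab.2
  have h3 : (⟨(p.1 b : ℕ) - 1, hi⟩ : Fin n) = i := Fin.ext (by simp [h1])
  rw [h3, ← h2]
  rfl

-- Multiplying the edge costs collects at each vertex its `vertexExponent`; the Abel summation bound
-- then raises every exponent above 1 by the common η = (1/2 - β) / k.
open Classical in
theorem expect_satisfies_constraints_le (hconn : H.Connected) (hdeg : ∀ v : W, 2 ≤ H.degree v)
    (hedges : k + 1 ≤ H.edgeFinset.card) (π : W ≃ Fin k) (hδ : 0 < δ) :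
    ∃ B : ℝ, 0 ≤ B ∧ ∃ η : ℝ, 0 < η ∧ ∀ (n : ℕ) (φ : W → Fin (n + 1)) (c : W × W → Fin m),
      (∀ u v, π u < π v ↔ φ u < φ v) →
      expect m hδ n (fun h => if Satisfies (constraints H π φ c) h then 1 else 0) ≤
        B * ∏ w, ((φ w : ℕ) + 1 : ℝ) ^ (-(1 + η)) := by
  obtain ⟨A, hA, hedge⟩ := exists_edge_bound (m := m) hδ
  set β : ℝ := m / (2 * m + δ) with hβ
  have hβ0 : 0 ≤ β := by positivity
  have hβ1 : β < 1 / 2 := beta_lt_half hδ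
  have hk : 0 < k := by
    obtain ⟨w⟩ := hconn.nonempty
    exact (Nat.zero_le _).trans_lt (π w).isLt
  have hk' : (0 : ℝ) < k := by exact_mod_cast hk
  set K : ℝ := m + δ + (orderedEdges H π).card with hK
  have hK0 : 0 < K := by positivity
  refine ⟨(K * A) ^ (orderedEdges H π).card, by positivity, (1 / 2 - β) / k,
    div_pos (by linarith) hk', fun n φ c hφ => ?_⟩
  have hlt : ∀ p ∈ orderedEdges H π, (φ p.1 : ℕ) < φ p.2 := fun p hp =>
    (hφ _ _).1 (Finset.mem_filter.1 hp).2.2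
  have hinj := injective_of_lt_iff hφ
  have h1 := expect_satisfies_le hδ (constraints H π φ c) (K := K) (n := n)
    (fun d hd => by
      obtain ⟨p, hp, rfl⟩ := Finset.mem_image.1 hd
      have := hlt p hp
      simp only
      omega)
    (by
      rw [hK]
      gcongr
      exact Finset.card_image_le)
    (fun d hd => by
      obtain ⟨p, hp, rfl⟩ := Finset.mem_image.1 hd
      have := hlt p hp
      have := (φ p.2).isLt
      simp only
      omega)
  -- Distinct edges of `H` give distinct constraints: the later endpoint has a positive label, so
  -- subtracting 1 loses nothing.
  rw [constraints, Finset.prod_image] at h1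
  swap
  · rintro ⟨a, b⟩ hp ⟨a', b'⟩ hp' e
    have h2 := hlt _ hp
    have h3 := hlt _ hp'
    simp only [Prod.mk.injEq] at e h2 h3
    refine Prod.ext (hinj (Fin.ext e.2.2)) (hinj (Fin.ext ?_))
    simp only
    omega
  set l : W → ℝ := fun w => Real.log ((φ w : ℕ) + 1) with hl
  refine h1.trans ?_
  calc _ ≤ ∏ p ∈ orderedEdges H π,
        ((K * A) * Real.exp (-((1 - β) * l p.2 + β * l p.1))) := by
        refine Finset.prod_le_prod (fun p hp => ?_) fun p hp => ?_
        · refine mul_nonneg hK0.le (mul_nonneg (Finset.prod_nonneg fun t _ => ?_) ?_)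
          · have := totalWeight_pos (m := m) hδ t
            positivity
          · exact inv_nonneg.2 (totalWeight_pos hδ _).le
        · have h2 := hlt p hp
          have h3 := hedge (φ p.1) ((φ p.2 : ℕ) - 1) (by omega)
          have h4 : (((φ p.2 : ℕ) - 1 : ℕ) : ℝ) + 2 = (φ p.2 : ℕ) + 1 := by
            rw [Nat.cast_sub (by omega)]
            push_cast
            ring
          rw [h4] at h3
          rw [mul_assoc]
          exact mul_le_mul_of_nonneg_left h3 hK0.le
    _ = (K * A) ^ (orderedEdges H π).card *
        Real.exp (-∑ w, vertexExponent H π β w * l w) := by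
        rw [Finset.prod_mul_distrib, Finset.prod_const, ← Real.exp_sum]
        congr 2
        rw [Finset.sum_neg_distrib, Finset.sum_add_distrib, ← Finset.mul_sum, ← Finset.mul_sum,
          sum_orderedEdges_fst H π l, sum_orderedEdges_snd H π l, Finset.mul_sum, Finset.mul_sum,
          ← Finset.sum_add_distrib]
        congr 1
        refine Finset.sum_congr rfl fun w _ => ?_
        rw [vertexExponent]
        ring
    _ ≤ (K * A) ^ (orderedEdges H π).card *
        Real.exp (-((1 + (1 / 2 - β) / k) * ∑ w, l w)) := by
        gcongr
        refine le_sum_vertexExponent_mul π hconn hdeg hedges hβ0 hβ1 l (fun u v huv => ?_)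
          fun w => Real.log_nonneg (by simp)
        have h2 : (φ u : ℕ) ≤ φ v := ((hφ u v).1 huv).le
        refine Real.log_le_log (by positivity) ?_
        gcongr
    _ = _ := by
        congr 1
        rw [Finset.mul_sum, ← Finset.sum_neg_distrib, Real.exp_sum]
        refine Finset.prod_congr rfl fun w _ => ?_
        rw [Real.rpow_def_of_pos (by positivity)]
        congr 1
        ring

theorem exists_expect_ncard_le (hconn : H.Connected) (hdeg : ∀ v : W, 2 ≤ H.degree v)
    (hedges : k + 1 ≤ H.edgeFinset.card) (π : W ≃ Fin k) (hδ : 0 < δ) :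
    ∃ B : ℝ, ∀ n : ℕ,
      expect m hδ n (fun h => ({p | IsEmbedding H π h p}.ncard : ℝ)) ≤ B := by
  classical
  obtain ⟨B, hB, η, hη, hprob⟩ := expect_satisfies_constraints_le (m := m) hconn hdeg hedges π hδ
  set f : ℕ → ℝ := fun v => ((v : ℝ) + 1) ^ (-(1 + η)) with hf
  have hf0 : ∀ v, 0 ≤ f v := fun v => by positivity
  have hsum : Summable f := by
    have h1 : Summable fun v : ℕ => (v : ℝ) ^ (-(1 + η)) :=
      Real.summable_nat_rpow.2 (by linarith)
    have h2 := (summable_nat_add_iff 1).2 h1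
    simpa [hf] using h2
  -- The order condition on placements is dropped, so the sum factors over the vertices; f is
  -- summable because its exponent is below -1.
  refine ⟨Fintype.card (W × W → Fin m) * (B * (∑' v, f v) ^ Fintype.card W), fun n => ?_⟩
  calc _ ≤ expect m hδ n (fun h => ∑ p ∈ Finset.univ.filter
        (fun p : (W → Fin (n + 1)) × (W × W → Fin m) => ∀ u v, π u < π v ↔ p.1 u < p.1 v),
        if Satisfies (constraints H π p.1 p.2) h then 1 else 0) := by
        refine expect_mono hδ fun h => ?_
        rw [Finset.sum_boole, Nat.cast_le, ← Set.ncard_coe_finset]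
        refine Set.ncard_le_ncard (fun p hp => ?_) (Set.toFinite _)
        have hp : IsEmbedding H π h p := hp
        simpa using ⟨hp.1, hp.satisfies⟩
    _ ≤ ∑ p : (W → Fin (n + 1)) × (W × W → Fin m), B * ∏ w, f (p.1 w) := by
        rw [expect_sum]
        refine (Finset.sum_le_sum fun p hp => hprob n p.1 p.2 (Finset.mem_filter.1 hp).2).trans ?_
        exact Finset.sum_le_sum_of_subset_of_nonneg (Finset.filter_subset _ _) fun p _ _ =>
          mul_nonneg hB (Finset.prod_nonneg fun w _ => hf0 _)
    _ = Fintype.card (W × W → Fin m) * (B * (∑ v : Fin (n + 1), f v) ^ Fintype.card W) := by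
        rw [Fintype.sum_prod_type_right]
        simp only [← Finset.mul_sum, Finset.sum_const, Finset.card_univ, nsmul_eq_mul]
        have := Finset.prod_univ_sum (fun _ : W => (Finset.univ : Finset (Fin (n + 1))))
          (fun _ v => f v)
        rw [Fintype.piFinset_univ] at this
        rw [← this, Finset.prod_const, Finset.card_univ]
        ring
    _ ≤ _ := by
        have h1 : ∑ v : Fin (n + 1), f v ≤ ∑' v, f v := by
          rw [Fin.sum_univ_eq_sum_range]
          exact hsum.sum_le_tsum _ fun v _ => hf0 v
        have h2 : 0 ≤ ∑ v : Fin (n + 1), f v := Finset.sum_nonneg fun v _ => hf0 v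
        gcongr

-- Edges are never removed, so an embedding survives every extension of the history.
open Classical in
theorem expect_exists_isEmbedding_mono (π : W ≃ Fin k) (hδ : 0 < δ) :
    Monotone fun n => expect m hδ n fun h => if ∃ p, IsEmbedding H π h p then 1 else 0 := by
  refine monotone_nat_of_le_succ fun n => ?_
  rw [expect_succ]
  refine expect_mono hδ fun h => ?_
  by_cases hp : ∃ p, IsEmbedding H π h p
  · have hp' : ∀ x, ∃ p, IsEmbedding H π (extend h x) p := fun x =>
      hp.elim fun p hp => ⟨_, hp.extend x⟩
    simp [hp, hp', sum_prod_attachProb_real hδ]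
  · rw [if_neg hp]
    refine Finset.sum_nonneg fun x _ => mul_nonneg (Finset.prod_nonneg fun j _ =>
      attachProb_nonneg hδ _ _) ?_
    positivity

/-- Place `H` on all the vertices by π itself. Each vertex has at most m earlier neighbours, so they
can be assigned distinct edge slots; unused slots point to the vertex 0. -/
theorem exists_history_isEmbedding (hm : 0 < m) {n : ℕ} (π : W ≃ Fin (n + 1))
    (hout : ∀ v : W, outDeg H π v ≤ m) :
    ∃ (h : History m n) (p : _), IsEmbedding H π h p := by
  classical
  have hemb : ∀ b : W, ∃ f : W → Fin m, ∀ a a', H.Adj a b → π a < π b → H.Adj a' b →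
      π a' < π b → f a = f a' → a = a' := by
    intro b
    set S := Finset.univ.filter fun u => H.Adj b u ∧ π u < π b with hS
    obtain ⟨g⟩ : Nonempty (S ↪ Fin m) :=
      Function.Embedding.nonempty_of_card_le (by
          rw [Fintype.card_coe, Fintype.card_fin]
          exact hout b)
    refine ⟨fun a => if ha : a ∈ S then g ⟨a, ha⟩ else ⟨0, hm⟩,
      fun a a' h1 h2 h3 h4 e => ?_⟩
    have ha : a ∈ S := by simp [hS, h1.symm, h2]
    have ha' : a' ∈ S := by simp [hS, h3.symm, h4]
    simp only [ha, ha', dif_pos] at e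
    simpa using g.injective e
  choose f hf using hemb
  have hhist : ∀ (i : Fin n) (j : Fin m), ∃ v : Fin ((i : ℕ) + 1), ∀ a b, H.Adj a b → π a < π b →
      π b = i.succ → f b a = j → (v : ℕ) = π a := by
    intro i j
    by_cases hex : ∃ a b, H.Adj a b ∧ π a < π b ∧ π b = i.succ ∧ f b a = j
    · obtain ⟨a, b, h1, h2, h3, h4⟩ := hex
      refine ⟨⟨π a, by simpa [h3, Fin.lt_def] using h2⟩, fun a' b' h1' h2' h3' h4' => ?_⟩
      obtain rfl : b = b' := π.injective (h3.trans h3'.symm)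
      obtain rfl := hf b a a' h1 h2 h1' h2' (h4.trans h4'.symm)
      rfl
    · exact ⟨0, fun a b h1 h2 h3 h4 => (hex ⟨a, b, h1, h2, h3, h4⟩).elim⟩
  choose h hh using hhist
  refine ⟨h, (π, fun p => f p.2 p.1), fun u v => Iff.rfl, fun a b hab hlt => ?_⟩
  obtain ⟨i, hi⟩ := Fin.exists_succ_eq_of_ne_zero (Fin.ne_zero_of_lt hlt)
  exact ⟨i, hi.symm, Fin.ext (hh i _ a b hab hlt hi.symm rfl)⟩

-- The constant is the probability of a single good history on k vertices; monotonicity carries it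
-- to all larger n.
open Classical in
theorem exists_le_expect_exists_isEmbedding (hm : 0 < m) (π : W ≃ Fin k) (hk : 0 < k) (hδ : 0 < δ)
    (hout : ∀ v : W, outDeg H π v ≤ m) :
    ∃ C : ℝ, 0 < C ∧ ∀ n : ℕ, k ≤ n + 1 →
      C ≤ expect m hδ n fun h => if ∃ p, IsEmbedding H π h p then 1 else 0 := by
  obtain ⟨n₀, rfl⟩ : ∃ n₀, k = n₀ + 1 := ⟨k - 1, by omega⟩
  obtain ⟨h, p, hp⟩ := exists_history_isEmbedding hm π hout
  refine ⟨_, law_toReal_pos hδ h, fun n hn => le_trans ?_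
    (expect_exists_isEmbedding_mono (H := H) π hδ (Nat.le_of_succ_le_succ hn))⟩
  have := Finset.single_le_sum (f := fun h => (law m hδ n₀ h).toReal *
    if ∃ p, IsEmbedding H π h p then 1 else 0)
    (fun h _ => mul_nonneg ENNReal.toReal_nonneg (by positivity)) (Finset.mem_univ h)
  rwa [if_pos ⟨p, hp⟩, mul_one] at this

end Bounds

end PrefAttach

/-! ### The theorem -/

theorem mainTheorem2 (m : ℕ) (hm : 2 ≤ m) (δ : ℝ) (hδ : 0 < δ)
    {W : Type*} [Fintype W] (k : ℕ) (H : SimpleGraph W) [DecidableRel H.Adj]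
    (hconn : H.Connected) (hdeg : ∀ v : W, 2 ≤ H.degree v)
    (hedges : k + 1 ≤ H.edgeFinset.card) (π : W ≃ Fin k) :
    (∃ C₁ C₂ : ℝ, 0 < C₁ ∧ C₁ ≤ C₂ ∧
      (∀ n : ℕ,
        PrefAttach.expect m hδ n (fun h => (PrefAttach.copies H π h : ℝ)) ≤ C₂ ∧
        PrefAttach.expect m hδ n (fun h => (PrefAttach.simpleCopies H π h : ℝ)) ≤ C₂) ∧
      ((∀ v : W, PrefAttach.outDeg H π v ≤ m) → ∀ n : ℕ, k ≤ n + 1 →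
        C₁ ≤ PrefAttach.expect m hδ n (fun h => (PrefAttach.copies H π h : ℝ)) ∧
        C₁ ≤ PrefAttach.expect m hδ n (fun h => (PrefAttach.simpleCopies H π h : ℝ)))) ∧
    PrefAttach.exponent H π m δ = -(k : ℝ) ∧
    (∀ s : ℕ, s ≤ k →
      (PrefAttach.exponentAt H π m δ s = PrefAttach.exponent H π m δ ↔ s = k)) := by
  classical
  have hm0 : 0 < m := by omega
  have hk : 0 < k := by
    obtain ⟨w⟩ := hconn.nonempty
    exact (Nat.zero_le _).trans_lt (π w).isLt
  have hexp := PrefAttach.exponent_eq π hconn hdeg hedges hm0 hδ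
  refine ⟨?_, hexp, fun s hs => ?_⟩
  · obtain ⟨B, hB⟩ := PrefAttach.exists_expect_ncard_le (m := m) hconn hdeg hedges π hδ
    obtain ⟨C, hC, hlow⟩ : ∃ C : ℝ, 0 < C ∧ ((∀ v : W, PrefAttach.outDeg H π v ≤ m) →
        ∀ n : ℕ, k ≤ n + 1 → C ≤ PrefAttach.expect m hδ n fun h =>
          if ∃ p, PrefAttach.IsEmbedding H π h p then 1 else 0) := by
      by_cases hout : ∀ v : W, PrefAttach.outDeg H π v ≤ m
      · obtain ⟨C, hC, hlow⟩ := PrefAttach.exists_le_expect_exists_isEmbedding hm0 π hk hδ hout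
        exact ⟨C, hC, fun _ => hlow⟩
      -- A positive constant is needed even if some out-degree exceeds m, when the lower bound is
      -- vacuous; any value will do.
      · exact ⟨1, one_pos, fun h => (hout h).elim⟩
    refine ⟨C, max B C, hC, le_max_right _ _, fun n => ⟨?_, ?_⟩, fun hout n hn => ⟨?_, ?_⟩⟩
    · refine (PrefAttach.expect_mono hδ fun h => ?_).trans ((hB n).trans (le_max_left _ _))
      exact_mod_cast PrefAttach.copies_le hm0 h
    · refine (PrefAttach.expect_mono hδ fun h => ?_).trans ((hB n).trans (le_max_left _ _))
      exact_mod_cast PrefAttach.simpleCopies_le hm0 h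
    · refine (hlow hout n hn).trans (PrefAttach.expect_mono hδ fun h => ?_)
      split_ifs with hp
      · exact_mod_cast PrefAttach.one_le_copies hp.choose_spec
      · positivity
    · refine (hlow hout n hn).trans (PrefAttach.expect_mono hδ fun h => ?_)
      split_ifs with hp
      · exact_mod_cast PrefAttach.one_le_simpleCopies hp.choose_spec
      · positivity
  · rw [hexp]
    constructor
    · intro h
      by_contra hne
      exact (PrefAttach.exponentAt_lt π hconn hdeg hedges hm0 hδ (lt_of_le_of_ne hs hne)).ne h
    · rintro rfl
      exact PrefAttach.exponentAt_last π m δ
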